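/- Let $(M,g)$ be a compact two-dimensional smooth manifold without boundary with a Riemannian metric $g$ of class $C^2$. Write $\nabla f$, $\mathrm{Hess}\,f$ and $\Delta f=\mathrm{tr}_g\,\mathrm{Hess}\,f$ for the Riemannian gradient, Hessian and Laplacian, $d\mathcal M$ and $\mathrm{vol}$ for the Riemannian volume, and put $\alpha=\frac n2-\frac12=\frac12$ (with $n=2$). Then for every $\varepsilon>0$ there exist a finite family $V_1,\dots,V_k$ of nonempty open subsets of $M$ with smooth boundary, functions $f_i:\overline{V_i}\to\mathbb R$ that are smooth (i.e. restrictions of smooth functions on a neighbourhood of $\overline{V_i}$), and a constant $C>0$ such that: 1. the closures $\overline{V_i}$ are pairwise disjoint; 2. $\mathrm{vol}\big(\bigcup_{i=1}^k V_i\big)\ge \mathrm{vol}(M)-\varepsilon$; 3. for every $i$ the multiplier inequality holds with the constant $C$, pointwise and in integrated form: at every point of $V_i$ one has $$\mathrm{Hess}\,f_i+\Big(\alpha-\frac{\Delta f_i}{2}\Big)g\ \ge\ C\,g \ \text{ (as quadratic forms)},\qquad \frac{\Delta f_i}{2}-\alpha\ \ge\ C ,$$ and for every $T>0$ and every $C^1$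 function $u:\mathbb R\times M\to\mathbb R$, $$C\int_0^T\!\!\int_{V_i}\big(|\nabla u|^2+u_t^2\big)\,d\mathcal M\,dt\ \le\ \int_0^T\!\!\int_{V_i}\Big[\mathrm{Hess}\,f_i(\nabla u,\nabla u)+\Big(\alpha-\frac{\Delta f_i}{2}\Big)|\nabla u|^2+\Big(\frac{\Delta f_i}{2}-\alpha\Big)u_t^2\Big]\,d\mathcal M\,dt ;$$ 4. $\inf_{x\in V_i}|\nabla f_i(x)|>0$ for every $i$. -/

import Mathlib

open Set MeasureTheory
open scoped Manifold ContDiff ENNReal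

set_option maxSynthPendingDepth 3

noncomputable section

namespace Riem

/-- The coordinate space `ℝⁿ`. -/
abbrev Coord (n : ℕ) : Type := EuclideanSpace ℝ (Fin n)

/-- A Riemannian metric of class `C^r` on the `n`-dimensional manifold `M`. -/
abbrev Metric (n : ℕ) (r : WithTop ℕ∞) (M : Type*) [TopologicalSpace M]
    [ChartedSpace (Coord n) M] [IsManifold (𝓡 n) ∞ M] :=
  Bundle.ContMDiffRiemannianMetric (𝓡 n) r (Coord n) (fun x : M => TangentSpace (𝓡 n) x)

/-- The Gram matrix `G_{ij}(y) = G(y)(∂_i, ∂_j)` of a field `G` of bilinear forms on `ℝⁿ`. -/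
def gram {n : ℕ} (G : Coord n → Coord n →L[ℝ] Coord n →L[ℝ] ℝ) (y : Coord n) :
    Matrix (Fin n) (Fin n) ℝ :=
  Matrix.of fun i j => G y (EuclideanSpace.single i 1) (EuclideanSpace.single j 1)

section Euclidean

variable {E : Type*} [NormedAddCommGroup E] [NormedSpace ℝ E]

/-- The Christoffel symbols of the first kind of a metric `G` on an open subset of
a normed space `E`:
`Γ(v, w; z) = (∂_v G(w, z) + ∂_w G(v, z) - ∂_z G(v, w)) / 2`, as a trilinear form. -/
def christoffelFirst (G : E → E →L[ℝ] E →L[ℝ] ℝ) (y : E) :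
    E →L[ℝ] E →L[ℝ] E →L[ℝ] ℝ :=
  let A : E →L[ℝ] E →L[ℝ] E →L[ℝ] ℝ := fderiv ℝ G y
  let B : E →L[ℝ] E →L[ℝ] E →L[ℝ] ℝ :=
    ((ContinuousLinearMap.flipₗᵢ ℝ E E ℝ).toContinuousLinearEquiv :
      (E →L[ℝ] E →L[ℝ] ℝ) →L[ℝ] (E →L[ℝ] E →L[ℝ] ℝ)) ∘L A.flip
  (1 / 2 : ℝ) • (A + A.flip - B)

theorem christoffelFirst_apply (G : E → E →L[ℝ] E →L[ℝ] ℝ)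
    (y v w z : E) :
    christoffelFirst G y v w z =
      (1 / 2) * (fderiv ℝ G y v w z + fderiv ℝ G y w v z - fderiv ℝ G y z v w) := by
  simp [christoffelFirst]

/-- The Christoffel symbols of `G` (of the second kind): `Γ(v, w)` is the vector with
`G(Γ(v, w), z) = Γ(v, w; z)` for all `z`; that is, `Γ(∂_i, ∂_j) = ∑ₖ Γᵏ_{ij} ∂_k`. -/
def christoffel (G : E → E →L[ℝ] E →L[ℝ] ℝ) (y : E) :
    E →L[ℝ] E →L[ℝ] E :=
  (ContinuousLinearMap.compL ℝ E (E →L[ℝ] ℝ) E (G y).inverse) ∘L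
    christoffelFirst G y

/-- The Hessian of `φ` with respect to the metric `G` on an open subset of
a normed space `E`:
`Hess φ (∂_i, ∂_j) = ∂_i ∂_j φ - ∑ₖ Γᵏ_{ij} ∂_k φ`. -/
def coordHess (G : E → E →L[ℝ] E →L[ℝ] ℝ) (φ : E → ℝ) (y : E) :
    E →L[ℝ] E →L[ℝ] ℝ :=
  fderiv ℝ (fderiv ℝ φ) y -
    (ContinuousLinearMap.compL ℝ E E ℝ (fderiv ℝ φ y)) ∘L christoffel G y

end Euclidean

section Manifold

variable {n : ℕ} {r : WithTop ℕ∞} {M : Type*} [TopologicalSpace M] [ChartedSpace (Coord n) M]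
  [IsManifold (𝓡 n) ∞ M]

/-- The expression of the metric in the chart `e`: at `y` in the target of `e`, the pull-back of
`g` under the differential of `e⁻¹` at `y`. -/
def metricInChart (g : Metric n r M) (e : OpenPartialHomeomorph M (Coord n)) (y : Coord n) :
    Coord n →L[ℝ] Coord n →L[ℝ] ℝ :=
  let D : Coord n →L[ℝ] TangentSpace (𝓡 n) (e.symm y) :=
    mfderiv (𝓡 n) (𝓡 n) e.symm y ∘L
      ((NormedSpace.fromTangentSpace (𝕜 := ℝ) y).symm :
        Coord n →L[ℝ] TangentSpace 𝓘(ℝ, Coord n) y)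
  (ContinuousLinearMap.precomp ℝ D) ∘L g.inner (e.symm y) ∘L D

/-- The Riemannian Hessian of `f` at `x`, a bilinear form on the tangent space at `x`, computed
with the Christoffel symbols of the preferred chart at `x`. -/
def hess (g : Metric n r M) (f : M → ℝ) (x : M) :
    TangentSpace (𝓡 n) x →L[ℝ] TangentSpace (𝓡 n) x →L[ℝ] ℝ :=
  let e : OpenPartialHomeomorph M (Coord n) := chartAt (Coord n) x
  let D : TangentSpace (𝓡 n) x →L[ℝ] Coord n := mvfderiv (𝓡 n) e x
  (ContinuousLinearMap.precomp ℝ D) ∘L coordHess (metricInChart g e) (f ∘ e.symm) (e x) ∘L D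

theorem hess_apply (g : Metric n r M) (f : M → ℝ) (x : M) (v w : TangentSpace (𝓡 n) x) :
    hess g f x v w =
      coordHess (metricInChart g (chartAt (Coord n) x)) (f ∘ (chartAt (Coord n) x).symm)
        (chartAt (Coord n) x x) (mvfderiv (𝓡 n) (chartAt (Coord n) x) x v)
        (mvfderiv (𝓡 n) (chartAt (Coord n) x) x w) :=
  rfl

/-- The Laplace-Beltrami operator: the trace of the Hessian with respect to the metric. -/
def laplacian (g : Metric n r M) (f : M → ℝ) (x : M) : ℝ :=
  LinearMap.trace ℝ (TangentSpace (𝓡 n) x)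
    (((g.inner x).inverse ∘L hess g f x :
      TangentSpace (𝓡 n) x →L[ℝ] TangentSpace (𝓡 n) x) :
        TangentSpace (𝓡 n) x →ₗ[ℝ] TangentSpace (𝓡 n) x)

/-- The Riemannian gradient: `g(grad f, v) = df(v)` for all `v`. -/
def grad (g : Metric n r M) (f : M → ℝ) (x : M) : TangentSpace (𝓡 n) x :=
  (g.inner x).inverse (mvfderiv (𝓡 n) f x)

/-- The norm of a tangent vector. -/
def tnorm (g : Metric n r M) {x : M} (v : TangentSpace (𝓡 n) x) : ℝ :=
  Real.sqrt (g.inner x v v)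

theorem isInvertible_inner (g : Metric n r M) (x : M) : (g.inner x).IsInvertible := by
  let B : Coord n →L[ℝ] (Coord n →L[ℝ] ℝ) := g.inner x
  have hinj : Function.Injective B.toLinearMap := by
    rw [← LinearMap.ker_eq_bot, LinearMap.ker_eq_bot']
    intro v hv
    by_contra hne
    have h1 : 0 < B v v := g.pos x v hne
    have h2 : B v v = 0 := by
      change (B.toLinearMap v) v = 0
      rw [hv]
      rfl
    exact h1.ne' h2
  have hdim : Module.finrank ℝ (Coord n) = Module.finrank ℝ (Coord n →L[ℝ] ℝ) := by
    rw [← (LinearMap.toContinuousLinearMap (𝕜 := ℝ) (E := Coord n) (F' := ℝ)).finrank_eq]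
    exact (Subspace.dual_finrank_eq (K := ℝ) (V := Coord n)).symm
  exact ⟨(LinearEquiv.ofInjectiveOfFinrankEq B.toLinearMap hinj hdim).toContinuousLinearEquiv,
    by ext v w; rfl⟩

theorem inner_grad (g : Metric n r M) (f : M → ℝ) (x : M) (v : TangentSpace (𝓡 n) x) :
    g.inner x (grad g f x) v = mvfderiv (𝓡 n) f x v := by
  have h : mvfderiv (𝓡 n) f x = g.inner x (grad g f x) :=
    ((isInvertible_inner g x).inverse_apply_eq).1 rfl
  exact (congrArg (fun L => L v) h).symm

/-- The Riemannian volume in the domain of the chart `e`: the measure `√det(g_{ij}) dy` on the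
target of `e`, transported to `M` by `e⁻¹`. -/
def chartVolume [MeasurableSpace M] (g : Metric n r M)
    (e : OpenPartialHomeomorph M (Coord n)) : Measure M :=
  ((volume.restrict e.target).withDensity
    (fun y => ENNReal.ofReal (Real.sqrt (gram (metricInChart g e) y).det))).map e.symm

/-- The Riemannian volume measure: the smallest measure which dominates, for every chart of the
atlas, the volume in the domain of that chart. (The volumes in two charts agree on the
intersection of the domains; so on each chart domain this measure is the volume in that chart.) -/
def vol [MeasurableSpace M] (g : Metric n r M) : Measure M :=
  ⨆ e ∈ atlas (Coord n) M, chartVolume g e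

/-- `V` has smooth boundary: near each boundary point, `V` is the sublevel set `{ρ < 0}` of a
smooth function `ρ` with non-vanishing differential. -/
def HasSmoothBoundary (n : ℕ) {M : Type*} [TopologicalSpace M] [ChartedSpace (Coord n) M]
    (V : Set M) : Prop :=
  ∀ p ∈ frontier V, ∃ (U : Set M) (ρ : M → ℝ), IsOpen U ∧ p ∈ U ∧
    ContMDiffOn (𝓡 n) 𝓘(ℝ, ℝ) ∞ ρ U ∧ mvfderiv (𝓡 n) ρ p ≠ 0 ∧
    V ∩ U = {x ∈ U | ρ x < 0}

/-- `f` is smooth on the (closed) set `K`: it is smooth on an open neighbourhood of `K`. -/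
def SmoothOnNhd (n : ℕ) {M : Type*} [TopologicalSpace M] [ChartedSpace (Coord n) M]
    (f : M → ℝ) (K : Set M) : Prop :=
  ∃ U : Set M, IsOpen U ∧ K ⊆ U ∧ ContMDiffOn (𝓡 n) 𝓘(ℝ, ℝ) ∞ f U

/-- The pointwise multiplier inequality on `V`: `Hess f + (α - Δf/2) g ≥ C g` as bilinear forms,
and `Δf/2 - α ≥ C`. -/
def PointwiseMultiplier (g : Metric n r M) (V : Set M) (f : M → ℝ) (α C : ℝ) : Prop :=
  ∀ x ∈ V,
    (∀ v : TangentSpace (𝓡 n) x,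
      C * g.inner x v v ≤ hess g f x v v + (α - laplacian g f x / 2) * g.inner x v v) ∧
    C ≤ laplacian g f x / 2 - α

/-- The integrated multiplier inequality on `V`: for all `T > 0` and all `C¹` functions
`u : ℝ × M → ℝ`,
`C ∫₀ᵀ ∫_V (|∇u|² + u_t²) ≤
  ∫₀ᵀ ∫_V [Hess f(∇u, ∇u) + (α - Δf/2) |∇u|² + (Δf/2 - α) u_t²]`. -/
def IntegralMultiplier [MeasurableSpace M] (g : Metric n r M) (V : Set M) (f : M → ℝ)
    (α C : ℝ) : Prop :=
  ∀ (T : ℝ) (u : ℝ → M → ℝ), 0 < T →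
    ContMDiff (𝓘(ℝ, ℝ).prod (𝓡 n)) 𝓘(ℝ, ℝ) 1 (fun p : ℝ × M => u p.1 p.2) →
    C * ∫ t in (0 : ℝ)..T, ∫ x in V,
        (tnorm g (grad g (u t) x) ^ 2 + deriv (fun s => u s x) t ^ 2) ∂(vol g) ≤
      ∫ t in (0 : ℝ)..T, ∫ x in V,
        (hess g f x (grad g (u t) x) (grad g (u t) x)
          + (α - laplacian g f x / 2) * tnorm g (grad g (u t) x) ^ 2
          + (laplacian g f x / 2 - α) * deriv (fun s => u s x) t ^ 2) ∂(vol g)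

end Manifold

end Riem

end

/-!
The multiplier inequality is an open condition that can be arranged at any single point. In
dimension two with `α = 1/2`, if `Hess f = g` at `p`, then `Δ f = 2` there, so that
`Hess f + (α - Δ f / 2) g = g / 2` and `Δ f / 2 - α = 1 / 2`. In a chart, the function `f` can be
taken as a quadratic polynomial: its differential at `p` is any nonzero covector, and its second
derivative is then adjusted to cancel the Christoffel term of the Hessian
(`exists_local_multiplier`). By continuity, the inequality holds with `C = 1/4` and without
critical points on all small chart discs around `p`.

To transfer this to the manifold, where the Hessian at `x` is defined through the preferred chart
at `x`, one needs that it may be computed in any chart (`hess_eq_coordHess`); this is the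
transformation law of the Christoffel symbols, `christoffel_pullback`. The integrated inequality
follows from the pointwise one, since its right hand side is continuous on the compact closed disc
(`integral_integral_mono_of_continuousOn`).

It remains to fill `M` up to volume `ε` by finitely many small chart discs with disjoint closures.
In one chart, this is the Besicovitch covering theorem, with the radii restricted to those allowed
at each centre (`exists_countable_multiplierDisc`). As the volume in a chart dominates the
Riemannian volume on the domain of this chart (`vol_le_chartVolume`, by the change of variables
formula), null sets in the chart are null for the Riemannian volume. Finitely many patches of finite
volume cover `M`, and they are treated one after the other, each in the complement of the closed
discs already chosen (`exists_finite_multiplierDisc_biUnion`).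
-/

noncomputable section

namespace Riem

open Filter Topology

/-! ### The Hessian in coordinates and its invariance -/

section Euclidean

variable {E : Type*} [NormedAddCommGroup E] [NormedSpace ℝ E]

theorem apply_christoffel {G : E → E →L[ℝ] E →L[ℝ] ℝ} {y : E} (hG : (G y).IsInvertible)
    (v w z : E) : G y (christoffel G y v w) z = christoffelFirst G y v w z := by
  have h : G y ((G y).inverse (christoffelFirst G y v w)) = christoffelFirst G y v w := by
    obtain ⟨L, hL⟩ := hG
    rw [← hL]
    simp
  exact congrArg (fun l => l z) h

theorem coordHess_apply (G : E → E →L[ℝ] E →L[ℝ] ℝ) (φ : E → ℝ) (y v w : E) :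
    coordHess G φ y v w =
      fderiv ℝ (fderiv ℝ φ) y v w - fderiv ℝ φ y (christoffel G y v w) := rfl

theorem fderiv_bilinear_apply {G : E → E →L[ℝ] E →L[ℝ] ℝ} {y : E}
    (hG : DifferentiableAt ℝ G y) (z v w : E) :
    fderiv ℝ (fun x => G x v w) y z = fderiv ℝ G y z v w := by
  have h1 : HasFDerivAt (fun x => G x v w)
      ((ContinuousLinearMap.apply ℝ ℝ w) ∘L (ContinuousLinearMap.apply ℝ (E →L[ℝ] ℝ) v) ∘L
        fderiv ℝ G y) y :=
    ((ContinuousLinearMap.apply ℝ ℝ w).hasFDerivAt).comp y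
      (((ContinuousLinearMap.apply ℝ (E →L[ℝ] ℝ) v).hasFDerivAt).comp y hG.hasFDerivAt)
  rw [h1.fderiv]
  rfl

theorem fderiv_bilinear_symm {G : E → E →L[ℝ] E →L[ℝ] ℝ} {y : E}
    (hG : DifferentiableAt ℝ G y) (hs : ∀ᶠ x in 𝓝 y, ∀ v w, G x v w = G x w v) (z v w : E) :
    fderiv ℝ G y z v w = fderiv ℝ G y z w v := by
  rw [← fderiv_bilinear_apply hG, ← fderiv_bilinear_apply hG]
  have : (fun x => G x v w) =ᶠ[𝓝 y] fun x => G x w v := hs.mono fun x hx => hx v w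
  rw [this.fderiv_eq]

theorem christoffel_symm {G : E → E →L[ℝ] E →L[ℝ] ℝ} {y : E}
    (hG : DifferentiableAt ℝ G y) (hs : ∀ᶠ x in 𝓝 y, ∀ v w, G x v w = G x w v) (v w : E) :
    christoffel G y v w = christoffel G y w v := by
  have h : christoffelFirst G y v w = christoffelFirst G y w v := by
    ext z
    rw [christoffelFirst_apply, christoffelFirst_apply, fderiv_bilinear_symm hG hs z v w]
    ring
  exact congrArg (G y).inverse h

theorem fderiv_fderiv_comp {τ : E → E} {φ : E → ℝ} {y : E}
    (hφ : ContDiffAt ℝ 2 φ (τ y)) (hτ : ContDiffAt ℝ 2 τ y) (v w : E) :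
    fderiv ℝ (fderiv ℝ (φ ∘ τ)) y v w =
      fderiv ℝ (fderiv ℝ φ) (τ y) (fderiv ℝ τ y v) (fderiv ℝ τ y w) +
        fderiv ℝ φ (τ y) (fderiv ℝ (fderiv ℝ τ) y v w) := by
  have hτ1 : DifferentiableAt ℝ τ y := hτ.differentiableAt (by norm_num)
  have h1 : fderiv ℝ (φ ∘ τ) =ᶠ[𝓝 y] fun x => (fderiv ℝ φ (τ x)) ∘L (fderiv ℝ τ x) := by
    have e1 : ∀ᶠ x in 𝓝 y, DifferentiableAt ℝ τ x :=
      (hτ.eventually (by simp)).mono fun x hx => hx.differentiableAt (by norm_num)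
    have e2 : ∀ᶠ x in 𝓝 y, DifferentiableAt ℝ φ (τ x) :=
      hτ1.continuousAt.eventually
        ((hφ.eventually (by simp)).mono fun x hx => hx.differentiableAt (by norm_num))
    filter_upwards [e1, e2] with x h1 h2
    exact fderiv_comp x h2 h1
  have dφ : DifferentiableAt ℝ (fderiv ℝ φ) (τ y) :=
    (hφ.fderiv_right (m := 1) (by norm_num)).differentiableAt (by norm_num)
  have dτ : DifferentiableAt ℝ (fderiv ℝ τ) y :=
    (hτ.fderiv_right (m := 1) (by norm_num)).differentiableAt (by norm_num)
  have dφτ : HasFDerivAt (fun x => fderiv ℝ φ (τ x))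
      ((fderiv ℝ (fderiv ℝ φ) (τ y)) ∘L (fderiv ℝ τ y)) y :=
    dφ.hasFDerivAt.comp y hτ1.hasFDerivAt
  rw [h1.fderiv_eq, (dφτ.clm_comp dτ.hasFDerivAt).fderiv]
  simp
  ring

section ChangeOfCoordinates

variable {G G' : E → E →L[ℝ] E →L[ℝ] ℝ} {τ : E → E} {y : E}

theorem fderiv_pullback (hG : DifferentiableAt ℝ G (τ y)) (hG' : DifferentiableAt ℝ G' y)
    (hτ : ContDiffAt ℝ 2 τ y)
    (h : ∀ᶠ x in 𝓝 y, ∀ v w, G' x v w = G (τ x) (fderiv ℝ τ x v) (fderiv ℝ τ x w)) (z v w : E) :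
    fderiv ℝ G' y z v w =
      fderiv ℝ G (τ y) (fderiv ℝ τ y z) (fderiv ℝ τ y v) (fderiv ℝ τ y w) +
      G (τ y) (fderiv ℝ (fderiv ℝ τ) y z v) (fderiv ℝ τ y w) +
      G (τ y) (fderiv ℝ τ y v) (fderiv ℝ (fderiv ℝ τ) y z w) := by
  have hτ1 : DifferentiableAt ℝ τ y := hτ.differentiableAt (by norm_num)
  have dτ : DifferentiableAt ℝ (fderiv ℝ τ) y :=
    (hτ.fderiv_right (m := 1) (by norm_num)).differentiableAt (by norm_num)
  have e : (fun x => G' x v w) =ᶠ[𝓝 y] fun x => G (τ x) (fderiv ℝ τ x v) (fderiv ℝ τ x w) :=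
    h.mono fun x hx => hx v w
  have dv (u : E) : HasFDerivAt (fun x => fderiv ℝ τ x u)
      ((ContinuousLinearMap.apply ℝ E u) ∘L fderiv ℝ (fderiv ℝ τ) y) y :=
    ((ContinuousLinearMap.apply ℝ E u).hasFDerivAt).comp y dτ.hasFDerivAt
  have dG : HasFDerivAt (fun x => G (τ x)) ((fderiv ℝ G (τ y)) ∘L (fderiv ℝ τ y)) y :=
    hG.hasFDerivAt.comp y hτ1.hasFDerivAt
  rw [← fderiv_bilinear_apply hG', e.fderiv_eq, ((dG.clm_apply (dv v)).clm_apply (dv w)).fderiv]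
  simp
  ring

/-- The transformation law of the Christoffel symbols: the second derivative of `τ` measures their
failure to be a tensor. -/
theorem christoffel_pullback (hG : DifferentiableAt ℝ G (τ y)) (hG' : DifferentiableAt ℝ G' y)
    (hτ : ContDiffAt ℝ 2 τ y)
    (h : ∀ᶠ x in 𝓝 y, ∀ v w, G' x v w = G (τ x) (fderiv ℝ τ x v) (fderiv ℝ τ x w))
    (hs : ∀ v w, G (τ y) v w = G (τ y) w v)
    (hinv : (G (τ y)).IsInvertible) (hinv' : (G' y).IsInvertible)
    (hsurj : Function.Surjective (fderiv ℝ τ y)) (v w : E) :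
    fderiv ℝ τ y (christoffel G' y v w) =
      fderiv ℝ (fderiv ℝ τ) y v w +
        christoffel G (τ y) (fderiv ℝ τ y v) (fderiv ℝ τ y w) := by
  have hsym : IsSymmSndFDerivAt ℝ τ y := hτ.isSymmSndFDerivAt (by simp)
  have hinj : Function.Injective (G (τ y)) := by
    obtain ⟨L, hL⟩ := hinv
    rw [← hL]
    exact L.injective
  -- both sides have the same product with every vector `Dτ z`
  apply hinj
  ext z'
  obtain ⟨z, rfl⟩ := hsurj z'
  have h0 := h.self_of_nhds
  rw [← h0, apply_christoffel hinv', map_add, add_apply,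
    apply_christoffel hinv, christoffelFirst_apply, christoffelFirst_apply,
    fderiv_pullback hG hG' hτ h, fderiv_pullback hG hG' hτ h, fderiv_pullback hG hG' hτ h,
    hsym.eq z v, hsym.eq z w, hsym.eq w v,
    hs (fderiv ℝ τ y v) (fderiv ℝ (fderiv ℝ τ) y w z),
    hs (fderiv ℝ τ y w) (fderiv ℝ (fderiv ℝ τ) y v z)]
  ring

/-- The Hessian is a tensor: the second derivative of `τ` in the transformation law of the
Christoffel symbols cancels the one in the chain rule for the second derivative of `φ ∘ τ`. -/
theorem coordHess_pullback (hG : DifferentiableAt ℝ G (τ y)) (hG' : DifferentiableAt ℝ G' y)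
    (hτ : ContDiffAt ℝ 2 τ y)
    (h : ∀ᶠ x in 𝓝 y, ∀ v w, G' x v w = G (τ x) (fderiv ℝ τ x v) (fderiv ℝ τ x w))
    (hs : ∀ v w, G (τ y) v w = G (τ y) w v)
    (hinv : (G (τ y)).IsInvertible) (hinv' : (G' y).IsInvertible)
    (hsurj : Function.Surjective (fderiv ℝ τ y))
    {φ φ' : E → ℝ} (hφ : ContDiffAt ℝ 2 φ (τ y)) (hφ' : φ' =ᶠ[𝓝 y] φ ∘ τ) (v w : E) :
    coordHess G' φ' y v w = coordHess G φ (τ y) (fderiv ℝ τ y v) (fderiv ℝ τ y w) := by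
  have hτ1 : DifferentiableAt ℝ τ y := hτ.differentiableAt (by norm_num)
  rw [coordHess_apply, coordHess_apply, hφ'.fderiv.fderiv_eq, hφ'.fderiv_eq,
    fderiv_fderiv_comp hφ hτ, fderiv_comp y (hφ.differentiableAt (by norm_num)) hτ1,
    ContinuousLinearMap.comp_apply,
    christoffel_pullback hG hG' hτ h hs hinv hinv' hsurj, map_add]
  ring

end ChangeOfCoordinates

section Continuity

variable {Ω : Set E} {G : E → E →L[ℝ] E →L[ℝ] ℝ}

theorem continuousOn_inverse [CompleteSpace E] (hG : ContinuousOn G Ω)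
    (hinv : ∀ y ∈ Ω, (G y).IsInvertible) :
    ContinuousOn (fun y => (G y).inverse) Ω := by
  intro y hy
  obtain ⟨L, hL⟩ := hinv y hy
  have h : ContinuousAt ContinuousLinearMap.inverse (G y) := by
    rw [← hL]
    exact (contDiffAt_map_inverse (n := 0) L).continuousAt
  exact h.comp_continuousWithinAt (hG y hy)

theorem continuousOn_christoffel [CompleteSpace E] (hΩ : IsOpen Ω) (hG : ContDiffOn ℝ 1 G Ω)
    (hinv : ∀ y ∈ Ω, (G y).IsInvertible) :
    ContinuousOn (fun y => christoffel G y) Ω := by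
  have h1 : ContinuousOn (fderiv ℝ G) Ω := hG.continuousOn_fderiv_of_isOpen hΩ le_rfl
  have h2 : ContinuousOn (christoffelFirst G) Ω := by
    have hflip : ContinuousOn
        (fun y => (show E →L[ℝ] E →L[ℝ] E →L[ℝ] ℝ from fderiv ℝ G y).flip) Ω :=
      (ContinuousLinearMap.flipₗᵢ ℝ E E (E →L[ℝ] ℝ)).continuous.comp_continuousOn h1
    exact (continuousOn_const (c := (1 / 2 : ℝ))).smul
      ((h1.add hflip).sub (continuousOn_const.clm_comp hflip))
  have h3 := continuousOn_inverse hG.continuousOn hinv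
  exact ((ContinuousLinearMap.compL ℝ E (E →L[ℝ] ℝ) E).continuous.comp_continuousOn h3).clm_comp h2

theorem continuousOn_coordHess [CompleteSpace E] (hΩ : IsOpen Ω) (hG : ContDiffOn ℝ 1 G Ω)
    (hinv : ∀ y ∈ Ω, (G y).IsInvertible) {φ : E → ℝ} (hφ : ContDiffOn ℝ 2 φ Ω) :
    ContinuousOn (fun y => coordHess G φ y) Ω := by
  have h1 : ContDiffOn ℝ 1 (fderiv ℝ φ) Ω := hφ.fderiv_of_isOpen hΩ (by norm_num)
  exact (h1.continuousOn_fderiv_of_isOpen hΩ le_rfl).sub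
    (((ContinuousLinearMap.compL ℝ E E ℝ).continuous.comp_continuousOn h1.continuousOn).clm_comp
      (continuousOn_christoffel hΩ hG hinv))

end Continuity

end Euclidean

/-! ### The multiplier inequality near a point -/

section LocalMultiplier

variable {E : Type*} [NormedAddCommGroup E] [NormedSpace ℝ E]

/-- The Laplacian of `φ` with respect to the metric `G` on an open subset of `E`. -/
def coordLaplacian (G : E → E →L[ℝ] E →L[ℝ] ℝ) (φ : E → ℝ) (y : E) : ℝ :=
  LinearMap.trace ℝ E (((G y).inverse ∘L coordHess G φ y : E →L[ℝ] E) : E →ₗ[ℝ] E)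

/-- A quadratic polynomial with prescribed differential `ℓ` at `y₀` and prescribed (symmetric)
second derivative `Q`. -/
theorem exists_quadratic (y₀ : E) (ℓ : E →L[ℝ] ℝ) (Q : E →L[ℝ] E →L[ℝ] ℝ)
    (hQ : ∀ v w, Q v w = Q w v) :
    ∃ φ : E → ℝ, ContDiff ℝ ∞ φ ∧ fderiv ℝ φ y₀ = ℓ ∧ fderiv ℝ (fderiv ℝ φ) y₀ = Q := by
  have h1 (y : E) : HasFDerivAt (fun y => ℓ y + (1 / 2 : ℝ) * Q (y - y₀) (y - y₀))
      (ℓ + Q (y - y₀)) y := by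
    have hid : HasFDerivAt (fun y : E => y - y₀) (ContinuousLinearMap.id ℝ E) y :=
      (hasFDerivAt_id y).sub_const y₀
    have h := ℓ.hasFDerivAt.add
      ((((Q.hasFDerivAt (x := y - y₀)).comp y hid).clm_apply hid).const_mul (1 / 2 : ℝ))
    refine h.congr_fderiv ?_
    ext w
    have := hQ w (y - y₀)
    simp only [map_sub, sub_apply] at this
    simp
    linarith
  have h2 : fderiv ℝ (fun y => ℓ y + (1 / 2 : ℝ) * Q (y - y₀) (y - y₀)) =
      fun y => ℓ + Q (y - y₀) := funext fun y => (h1 y).fderiv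
  refine ⟨fun y => ℓ y + (1 / 2 : ℝ) * Q (y - y₀) (y - y₀), by fun_prop, by rw [h2]; simp, ?_⟩
  rw [h2]
  have hid : HasFDerivAt (fun y : E => y - y₀) (ContinuousLinearMap.id ℝ E) y₀ :=
    (hasFDerivAt_id y₀).sub_const y₀
  exact ((HasFDerivAt.comp (g := Q) y₀ Q.hasFDerivAt hid).const_add ℓ).fderiv

variable [FiniteDimensional ℝ E]

theorem isInvertible_of_pos {B : E →L[ℝ] E →L[ℝ] ℝ} (hB : ∀ v, v ≠ 0 → 0 < B v v) :
    B.IsInvertible := by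
  have hinj : Function.Injective B.toLinearMap := by
    rw [← LinearMap.ker_eq_bot, LinearMap.ker_eq_bot']
    intro v hv
    by_contra hne
    have h2 : B v v = 0 := by
      change (B.toLinearMap v) v = 0
      rw [hv]
      rfl
    exact (hB v hne).ne' h2
  have hdim : Module.finrank ℝ E = Module.finrank ℝ (E →L[ℝ] ℝ) := by
    rw [← (LinearMap.toContinuousLinearMap (𝕜 := ℝ) (E := E) (F' := ℝ)).finrank_eq]
    exact (Subspace.dual_finrank_eq (K := ℝ) (V := E)).symm
  exact ⟨(LinearEquiv.ofInjectiveOfFinrankEq B.toLinearMap hinj hdim).toContinuousLinearEquiv,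
    by ext v w; rfl⟩

/-- In finite dimension a form close to a positive definite one is nonnegative. -/
theorem eventually_nonneg_of_pos {B : E →L[ℝ] E →L[ℝ] ℝ} (hB : ∀ v, v ≠ 0 → 0 < B v v) :
    ∀ᶠ B' in 𝓝 B, ∀ v, 0 ≤ B' v v := by
  have hc : Continuous fun p : (E →L[ℝ] E →L[ℝ] ℝ) × E => p.1 p.2 p.2 := by fun_prop
  have hK : IsCompact (Metric.sphere (0 : E) 1) := isCompact_sphere 0 1
  have h1 : ∀ᶠ B' in 𝓝 B, ∀ v ∈ Metric.sphere (0 : E) 1, 0 < B' v v := by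
    refine hK.eventually_forall_of_forall_eventually fun v hv => ?_
    have hv0 : v ≠ 0 := by
      rintro rfl
      simp at hv
    exact hc.continuousAt.eventually (lt_mem_nhds (hB v hv0))
  filter_upwards [h1] with B' hB' v
  rcases eq_or_ne v 0 with rfl | hv
  · simp
  · have hn : ‖v‖ ≠ 0 := norm_ne_zero_iff.2 hv
    have h2 := hB' (‖v‖⁻¹ • v) (by simp [norm_smul, hn])
    have h3 : B' v v = ‖v‖ ^ 2 * B' (‖v‖⁻¹ • v) (‖v‖⁻¹ • v) := by
      simp only [map_smul, smul_apply, smul_eq_mul]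
      field_simp
    rw [h3]
    positivity

theorem continuousOn_coordLaplacian {Ω : Set E} {G : E → E →L[ℝ] E →L[ℝ] ℝ} (hΩ : IsOpen Ω)
    (hG : ContDiffOn ℝ 1 G Ω) (hinv : ∀ y ∈ Ω, (G y).IsInvertible) {φ : E → ℝ}
    (hφ : ContDiffOn ℝ 2 φ Ω) : ContinuousOn (coordLaplacian G φ) Ω := by
  have h : ContinuousOn (fun y => (G y).inverse ∘L coordHess G φ y) Ω :=
    (continuousOn_inverse hG.continuousOn hinv).clm_comp (continuousOn_coordHess hΩ hG hinv hφ)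
  have ht : Continuous fun A : E →L[ℝ] E => LinearMap.trace ℝ E (A : E →ₗ[ℝ] E) :=
    LinearMap.continuous_of_finiteDimensional
      ((LinearMap.trace ℝ E) ∘ₗ (ContinuousLinearMap.coeLM ℝ : (E →L[ℝ] E) →ₗ[ℝ] E →ₗ[ℝ] E))
  exact ht.comp_continuousOn h

/-- Near every point of a surface there is a smooth function `φ` with gradient bounded away from
zero which satisfies the multiplier inequality with `α = 1/2` and the constant `1/4`. At the point
itself, `Hess φ` is the metric, so that `Δ φ = 2` there. -/
theorem exists_local_multiplier (hE : Module.finrank ℝ E = 2) {Ω : Set E}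
    {G : E → E →L[ℝ] E →L[ℝ] ℝ} (hΩ : IsOpen Ω) (hG : ContDiffOn ℝ 1 G Ω)
    (hs : ∀ y ∈ Ω, ∀ v w, G y v w = G y w v) (hpos : ∀ y ∈ Ω, ∀ v, v ≠ 0 → 0 < G y v v)
    {y₀ : E} (hy₀ : y₀ ∈ Ω) :
    ∃ φ : E → ℝ, ContDiff ℝ ∞ φ ∧ ∃ c > 0, ∀ᶠ y in 𝓝 y₀,
      (∀ v, 1 / 4 * G y v v ≤ coordHess G φ y v v + (1 / 2 - coordLaplacian G φ y / 2) * G y v v) ∧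
      1 / 4 ≤ coordLaplacian G φ y / 2 - 1 / 2 ∧
      c ≤ fderiv ℝ φ y ((G y).inverse (fderiv ℝ φ y)) := by
  have hinv : ∀ y ∈ Ω, (G y).IsInvertible := fun y hy => isInvertible_of_pos (hpos y hy)
  have : Nontrivial E := Module.nontrivial_of_finrank_pos (R := ℝ) (by omega)
  obtain ⟨e, he⟩ := exists_ne (0 : E)
  have hΩn := hΩ.mem_nhds hy₀
  have hdG : DifferentiableAt ℝ G y₀ :=
    (hG.contDiffAt hΩn).differentiableAt (by norm_num)
  have hΓ := christoffel_symm hdG (Filter.mem_of_superset hΩn hs)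
  -- the second derivative is chosen so that `Hess φ = G` at `y₀`
  obtain ⟨φ, hφ, hφ1, hφ2⟩ := exists_quadratic y₀ (G y₀ e)
    (G y₀ + (ContinuousLinearMap.compL ℝ E E ℝ (G y₀ e)) ∘L christoffel G y₀) (by
      intro v w
      simp [hs y₀ hy₀ v w, hΓ v w])
  have hH : coordHess G φ y₀ = G y₀ := by
    ext v w
    rw [coordHess_apply, hφ1, hφ2]
    simp
  have hL : coordLaplacian G φ y₀ = 2 := by
    rw [coordLaplacian, hH]
    have : (G y₀).inverse ∘L G y₀ = ContinuousLinearMap.id ℝ E := by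
      obtain ⟨L, hL⟩ := hinv y₀ hy₀
      rw [← hL]
      ext v
      simp
    rw [this]
    simp [hE]
  have hφ2' : ContDiffOn ℝ 2 φ Ω := (contDiff_infty.1 hφ 2).contDiffOn
  have cG : ContinuousAt G y₀ := hdG.continuousAt
  have cH : ContinuousAt (coordHess G φ) y₀ :=
    (continuousOn_coordHess hΩ hG hinv hφ2').continuousAt hΩn
  have cL : ContinuousAt (coordLaplacian G φ) y₀ :=
    (continuousOn_coordLaplacian hΩ hG hinv hφ2').continuousAt hΩn
  have cI : ContinuousAt (fun y => (G y).inverse) y₀ :=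
    (continuousOn_inverse hG.continuousOn hinv).continuousAt hΩn
  have cφ : ContinuousAt (fderiv ℝ φ) y₀ :=
    (hφ.continuous_fderiv (by simp)).continuousAt
  -- the form on the left equals `G / 4` at `y₀`
  have e1 : ∀ᶠ y in 𝓝 y₀, ∀ v, 0 ≤ (coordHess G φ y +
      (1 / 2 - coordLaplacian G φ y / 2 - 1 / 4 : ℝ) • G y) v v := by
    have cB : ContinuousAt (fun y => coordHess G φ y +
        (1 / 2 - coordLaplacian G φ y / 2 - 1 / 4 : ℝ) • G y) y₀ :=
      cH.add (((continuousAt_const.sub (cL.div_const 2)).sub continuousAt_const).smul cG)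
    refine cB.eventually (eventually_nonneg_of_pos fun v hv => ?_)
    have := hpos y₀ hy₀ v hv
    simp only [hH, hL, add_apply, smul_apply, smul_eq_mul]
    linarith
  have e2 : ∀ᶠ y in 𝓝 y₀, 1 / 4 < coordLaplacian G φ y / 2 - 1 / 2 :=
    ((cL.div_const 2).sub continuousAt_const).eventually (lt_mem_nhds (by
      simp only [Pi.sub_apply, hL]
      norm_num))
  have hge : 0 < G y₀ e e := hpos y₀ hy₀ e he
  have e3 : ∀ᶠ y in 𝓝 y₀, G y₀ e e / 2 < fderiv ℝ φ y ((G y).inverse (fderiv ℝ φ y)) := by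
    have c3 : ContinuousAt (fun y => fderiv ℝ φ y ((G y).inverse (fderiv ℝ φ y))) y₀ :=
      cφ.clm_apply (cI.clm_apply cφ)
    refine c3.eventually (lt_mem_nhds ?_)
    have : (G y₀).inverse (G y₀ e) = e := by
      obtain ⟨L, hL⟩ := hinv y₀ hy₀
      rw [← hL]
      simp
    simp only [hφ1, this]
    linarith
  refine ⟨φ, hφ, G y₀ e e / 2, by positivity, ?_⟩
  filter_upwards [e1, e2, e3] with y h1 h2 h3
  refine ⟨fun v => ?_, h2.le, h3.le⟩
  have := h1 v
  simp only [add_apply, smul_apply, smul_eq_mul] at this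
  linarith

end LocalMultiplier

/-! ### The metric, gradient, Hessian and Laplacian in a chart -/

section Charts

variable {n : ℕ} {r : WithTop ℕ∞} {M : Type*} [TopologicalSpace M] [ChartedSpace (Coord n) M]
  [IsManifold (𝓡 n) ∞ M]

/-- The metric at `x` as a form on the model space, to which all tangent spaces are equal by
definition. In this form, it can be rewritten along equalities of base points. -/
def innerAt (g : Metric n r M) (x : M) : Coord n →L[ℝ] Coord n →L[ℝ] ℝ := g.inner x

/-- The gradient of `f` at `x`, as a vector of the model space. -/
def gradAt (g : Metric n r M) (f : M → ℝ) (x : M) : Coord n := grad g f x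

/-- The Hessian of `f` at `x`, as a form on the model space. -/
def hessAt (g : Metric n r M) (f : M → ℝ) (x : M) : Coord n →L[ℝ] Coord n →L[ℝ] ℝ := hess g f x

/-- The differential at `x` of the chart `e`, as a map of the model space. -/
def chartDeriv (e : OpenPartialHomeomorph M (Coord n)) (x : M) : Coord n →L[ℝ] Coord n :=
  mvfderiv (𝓡 n) e x

/-- The differential at `y` of the inverse of the chart `e`, as a map of the model space. -/
def chartDerivSymm (e : OpenPartialHomeomorph M (Coord n)) (y : Coord n) : Coord n →L[ℝ] Coord n :=
  mfderiv (𝓡 n) (𝓡 n) e.symm y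

theorem metricInChart_apply (g : Metric n r M) (e : OpenPartialHomeomorph M (Coord n))
    (y v w : Coord n) : metricInChart g e y v w =
      innerAt g (e.symm y) (chartDerivSymm e y v) (chartDerivSymm e y w) := rfl

variable {e e' : OpenPartialHomeomorph M (Coord n)}

theorem chartDerivSymm_chartDeriv (he : e ∈ atlas (Coord n) M) {x : M} (hx : x ∈ e.source)
    (v : Coord n) : chartDerivSymm e (e x) (chartDeriv e x v) = v := by
  have : IsManifold (𝓡 n) 1 M := .of_le (n := ∞) (by norm_num)
  exact DFunLike.congr_fun ((mdifferentiable_of_mem_atlas (I := 𝓡 n) he).symm_comp_deriv hx) v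

theorem chartDeriv_chartDerivSymm (he : e ∈ atlas (Coord n) M) {x : M} (hx : x ∈ e.source)
    (v : Coord n) : chartDeriv e x (chartDerivSymm e (e x) v) = v := by
  have : IsManifold (𝓡 n) 1 M := .of_le (n := ∞) (by norm_num)
  have h : chartDeriv e (e.symm (e x)) (chartDerivSymm e (e x) v) = v := DFunLike.congr_fun
    ((mdifferentiable_of_mem_atlas (I := 𝓡 n) he).comp_symm_deriv (e.map_source hx)) v
  rwa [e.left_inv hx] at h

theorem chartDerivSymm_injective (he : e ∈ atlas (Coord n) M) {y : Coord n} (hy : y ∈ e.target) :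
    Function.Injective (chartDerivSymm e y) := by
  have h := chartDeriv_chartDerivSymm he (e.map_target hy)
  rw [e.right_inv hy] at h
  exact Function.LeftInverse.injective h

theorem metricInChart_chartDeriv (g : Metric n r M) (he : e ∈ atlas (Coord n) M) {x : M}
    (hx : x ∈ e.source) (v w : Coord n) :
    metricInChart g e (e x) (chartDeriv e x v) (chartDeriv e x w) = innerAt g x v w := by
  rw [metricInChart_apply, chartDerivSymm_chartDeriv he hx, chartDerivSymm_chartDeriv he hx,
    e.left_inv hx]

theorem metricInChart_symm (g : Metric n r M) (e : OpenPartialHomeomorph M (Coord n))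
    (y v w : Coord n) : metricInChart g e y v w = metricInChart g e y w v :=
  g.symm _ _ _

theorem metricInChart_pos (g : Metric n r M) (he : e ∈ atlas (Coord n) M)
    {y : Coord n} (hy : y ∈ e.target) (v : Coord n) (hv : v ≠ 0) :
    0 < metricInChart g e y v v :=
  g.pos _ _ fun h => hv (chartDerivSymm_injective he hy (h.trans (map_zero _).symm))

theorem isInvertible_metricInChart (g : Metric n r M) (he : e ∈ atlas (Coord n) M)
    {y : Coord n} (hy : y ∈ e.target) : (metricInChart g e y).IsInvertible :=
  isInvertible_of_pos (metricInChart_pos g he hy)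

theorem contDiffOn_metricInChart (g : Metric n 2 M) (he : e ∈ atlas (Coord n) M) :
    ContDiffOn ℝ 2 (metricInChart g e) e.target := by
  have : IsManifold (𝓡 n) 1 M := .of_le (n := ∞) (by norm_num)
  have : IsManifold (𝓡 n) 2 M := .of_le (n := ∞) ENat.LEInfty.out
  have : IsManifold (𝓡 n) 3 M := .of_le (n := ∞) ENat.LEInfty.out
  have he3 : ContMDiffOn (𝓡 n) (𝓡 n) 3 e.symm e.target :=
    contMDiffOn_symm_of_mem_maximalAtlas (IsManifold.subset_maximalAtlas he)
  -- the coordinate vector fields are smooth sections of `TM` along `e.symm`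
  have hsec (v : Coord n) : ContMDiffOn (𝓡 n) (𝓡 n).tangent 2
      (fun y => (⟨e.symm y, chartDerivSymm e y v⟩ : TangentBundle (𝓡 n) M)) e.target := by
    have h1 : ContMDiff (𝓡 n) (𝓡 n).tangent 2
        (fun y : Coord n => (⟨y, v⟩ : TangentBundle (𝓡 n) (Coord n))) := fun y =>
      (contMDiffAt_vectorSpace_iff_contDiffAt (V := fun _ => v)).2 contDiffAt_const
    have h2 := he3.contMDiffOn_tangentMapWithin (m := 2) (by norm_num)
      e.open_target.uniqueMDiffOn
    have h3 := h2.comp (s := e.target) h1.contMDiffOn (fun y hy => hy)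
    refine h3.congr fun y hy => ?_
    simp only [Function.comp, tangentMapWithin, mfderivWithin_of_isOpen e.open_target hy]
    rfl
  have hg : ContMDiffOn (𝓡 n) ((𝓡 n).prod 𝓘(ℝ, Coord n →L[ℝ] Coord n →L[ℝ] ℝ)) 2
      (fun y => Bundle.TotalSpace.mk' (Coord n →L[ℝ] Coord n →L[ℝ] ℝ)
        (E := fun x : M => TangentSpace (𝓡 n) x →L[ℝ] TangentSpace (𝓡 n) x →L[ℝ] ℝ)
        (e.symm y) (g.inner (e.symm y))) e.target :=
    g.contMDiff.comp_contMDiffOn (he3.of_le (by norm_num))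
  rw [contDiffOn_clm_apply]
  intro v
  rw [contDiffOn_clm_apply]
  intro w
  rw [← contMDiffOn_iff_contDiffOn]
  intro y hy
  have := ContMDiffWithinAt.clm_bundle_apply₂ (F₁ := Coord n) (F₂ := Coord n) (F₃ := ℝ)
    (E₁ := fun x : M => TangentSpace (𝓡 n) x) (E₂ := fun x : M => TangentSpace (𝓡 n) x)
    (E₃ := Bundle.Trivial M ℝ) (hg y hy) (hsec v y hy) (hsec w y hy)
  simp only [Bundle.contMDiffWithinAt_totalSpace] at this
  exact this.2

/-! ### Change of charts -/

theorem contDiffAt_transition (he : e ∈ atlas (Coord n) M) (he' : e' ∈ atlas (Coord n) M) {x : M}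
    (hx : x ∈ e.source) (hx' : x ∈ e'.source) : ContDiffAt ℝ ∞ (e ∘ e'.symm) (e' x) := by
  rw [← contMDiffAt_iff_contDiffAt]
  have h1 : ContMDiffAt (𝓡 n) (𝓡 n) ∞ e (e'.symm (e' x)) := by
    rw [e'.left_inv hx']
    exact contMDiffAt_of_mem_maximalAtlas (IsManifold.subset_maximalAtlas he) hx
  exact h1.comp _ (contMDiffAt_symm_of_mem_maximalAtlas (IsManifold.subset_maximalAtlas he')
    (e'.map_source hx'))

theorem mvfderiv_eq_fderiv_chart {F : Type*} [NormedAddCommGroup F] [NormedSpace ℝ F]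
    (he : e ∈ atlas (Coord n) M) {x : M} (hx : x ∈ e.source) {f : M → F}
    (hf : MDifferentiableAt (𝓡 n) 𝓘(ℝ, F) f x) (v : TangentSpace (𝓡 n) x) :
    mvfderiv (𝓡 n) f x v = fderiv ℝ (f ∘ e.symm) (e x) (chartDeriv e x v) := by
  have : IsManifold (𝓡 n) 1 M := .of_le (n := ∞) (by norm_num)
  have hc : MDifferentiableAt (𝓡 n) 𝓘(ℝ, F) (f ∘ e.symm) (e x) := by
    have h1 : MDifferentiableAt (𝓡 n) 𝓘(ℝ, F) f (e.symm (e x)) := by rwa [e.left_inv hx]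
    exact h1.comp _ (mdifferentiableAt_atlas_symm he (e.map_source hx))
  have hev : f =ᶠ[𝓝 x] (f ∘ e.symm) ∘ e := by
    filter_upwards [e.open_source.mem_nhds hx] with z hz
    simp [e.left_inv hz]
  have h := mfderiv_comp x hc (mdifferentiableAt_atlas he hx)
  have h2 := hev.mfderiv_eq (I := 𝓡 n) (I' := 𝓘(ℝ, F))
  rw [h, mfderiv_eq_fderiv] at h2
  exact DFunLike.congr_fun h2 v

theorem chartDeriv_eq_fderiv_transition (he : e ∈ atlas (Coord n) M)
    (he' : e' ∈ atlas (Coord n) M) {x : M} (hx : x ∈ e.source) (hx' : x ∈ e'.source)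
    (v : Coord n) :
    chartDeriv e x v = fderiv ℝ (e ∘ e'.symm) (e' x) (chartDeriv e' x v) := by
  have : IsManifold (𝓡 n) 1 M := .of_le (n := ∞) (by norm_num)
  exact mvfderiv_eq_fderiv_chart he' hx' (mdifferentiableAt_atlas he hx) v

theorem metricInChart_transition (g : Metric n r M) (he : e ∈ atlas (Coord n) M)
    (he' : e' ∈ atlas (Coord n) M) {x : M} (hx : x ∈ e.source) (hx' : x ∈ e'.source)
    (v w : Coord n) :
    metricInChart g e' (e' x) v w = metricInChart g e (e x)
      (fderiv ℝ (e ∘ e'.symm) (e' x) v) (fderiv ℝ (e ∘ e'.symm) (e' x) w) := by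
  have key (v : Coord n) : fderiv ℝ (e ∘ e'.symm) (e' x) v =
      chartDeriv e x (chartDerivSymm e' (e' x) v) := by
    rw [chartDeriv_eq_fderiv_transition he he' hx hx', chartDeriv_chartDerivSymm he' hx']
  rw [key, key, metricInChart_chartDeriv g he hx, metricInChart_apply, e'.left_inv hx']

theorem chartDeriv_surjective (he : e ∈ atlas (Coord n) M) {x : M} (hx : x ∈ e.source) :
    Function.Surjective (chartDeriv e x) :=
  fun v => ⟨_, chartDeriv_chartDerivSymm he hx v⟩

theorem fderiv_transition_surjective (he : e ∈ atlas (Coord n) M)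
    (he' : e' ∈ atlas (Coord n) M) {x : M} (hx : x ∈ e.source) (hx' : x ∈ e'.source) :
    Function.Surjective (fderiv ℝ (e ∘ e'.symm) (e' x)) := fun v => by
  obtain ⟨w, rfl⟩ := chartDeriv_surjective he hx v
  exact ⟨_, (chartDeriv_eq_fderiv_transition he he' hx hx' w).symm⟩

/-- The Riemannian Hessian can be computed in any chart of the atlas. -/
theorem hess_eq_coordHess (g : Metric n 2 M) (he : e ∈ atlas (Coord n) M) {x : M}
    (hx : x ∈ e.source) {f : M → ℝ} (hf : ContDiffAt ℝ 2 (f ∘ e.symm) (e x))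
    (v w : Coord n) :
    hessAt g f x v w = coordHess (metricInChart g e) (f ∘ e.symm) (e x)
      (chartDeriv e x v) (chartDeriv e x w) := by
  have he' : chartAt (Coord n) x ∈ atlas (Coord n) M := chart_mem_atlas _ x
  have hx' : x ∈ (chartAt (Coord n) x).source := mem_chart_source _ x
  change coordHess (metricInChart g (chartAt (Coord n) x)) (f ∘ (chartAt (Coord n) x).symm)
    (chartAt (Coord n) x x) (chartDeriv (chartAt (Coord n) x) x v)
    (chartDeriv (chartAt (Coord n) x) x w) = _
  rw [chartDeriv_eq_fderiv_transition he he' hx hx', chartDeriv_eq_fderiv_transition he he' hx hx']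
  generalize chartAt (Coord n) x = e' at *
  have hτx : (e ∘ e'.symm) (e' x) = e x := by simp [e'.left_inv hx']
  have hev : ∀ᶠ y in 𝓝 (e' x), y ∈ e'.target ∧ e'.symm y ∈ e.source :=
    (e'.open_target.eventually_mem (e'.map_source hx')).and
      ((e'.continuousAt_symm (e'.map_source hx')).eventually
        (by rw [e'.left_inv hx']; exact e.open_source.eventually_mem hx))
  rw [← hτx]
  refine coordHess_pullback ?_ ?_ ?_ ?_ ?_ ?_ ?_ ?_ ?_ ?_ _ _
  · rw [hτx]
    exact ((contDiffOn_metricInChart g he).contDiffAt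
      (e.open_target.mem_nhds (e.map_source hx))).differentiableAt (by norm_num)
  · exact ((contDiffOn_metricInChart g he').contDiffAt
      (e'.open_target.mem_nhds (e'.map_source hx'))).differentiableAt (by norm_num)
  · exact (contDiffAt_transition he he' hx hx').of_le ENat.LEInfty.out
  · filter_upwards [hev] with y hy v w
    have := metricInChart_transition g he he' hy.2 (e'.map_target hy.1) v w
    rwa [e'.right_inv hy.1] at this
  · exact metricInChart_symm g e _
  · rw [hτx]
    exact isInvertible_metricInChart g he (e.map_source hx)
  · exact isInvertible_metricInChart g he' (e'.map_source hx')
  · exact fderiv_transition_surjective he he' hx hx'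
  · rwa [hτx]
  · filter_upwards [hev] with y hy
    simp [e.left_inv hy.2]

theorem chartDeriv_grad (g : Metric n r M) (he : e ∈ atlas (Coord n) M) {x : M}
    (hx : x ∈ e.source) {f : M → ℝ} (hf : MDifferentiableAt (𝓡 n) 𝓘(ℝ, ℝ) f x) :
    chartDeriv e x (gradAt g f x) =
      (metricInChart g e (e x)).inverse (fderiv ℝ (f ∘ e.symm) (e x)) := by
  have hinv := isInvertible_metricInChart g he (e.map_source hx)
  symm
  rw [hinv.inverse_apply_eq]
  ext z
  obtain ⟨w, rfl⟩ := chartDeriv_surjective he hx z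
  rw [metricInChart_chartDeriv g he hx]
  exact (mvfderiv_eq_fderiv_chart he hx hf w).symm.trans (inner_grad g f x w).symm

/-- The Laplacian can be computed in any chart of the atlas. -/
theorem laplacian_eq_coordLaplacian (g : Metric n 2 M) (he : e ∈ atlas (Coord n) M) {x : M}
    (hx : x ∈ e.source) {f : M → ℝ} (hf : ContDiffAt ℝ 2 (f ∘ e.symm) (e x)) :
    laplacian g f x = coordLaplacian (metricInChart g e) (f ∘ e.symm) (e x) := by
  have hinv := isInvertible_metricInChart g he (e.map_source hx)
  let D : Coord n ≃ₗ[ℝ] Coord n := LinearEquiv.ofBijective (chartDeriv e x : Coord n →ₗ[ℝ] Coord n)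
    ⟨Function.LeftInverse.injective (chartDerivSymm_chartDeriv he hx), chartDeriv_surjective he hx⟩
  let A : Coord n →ₗ[ℝ] Coord n := (((g.inner x).inverse ∘L hess g f x :
      TangentSpace (𝓡 n) x →L[ℝ] TangentSpace (𝓡 n) x) :
        TangentSpace (𝓡 n) x →ₗ[ℝ] TangentSpace (𝓡 n) x)
  change LinearMap.trace ℝ (Coord n) A = _
  -- the endomorphisms in the tangent space and in the chart are conjugate by `D`
  rw [← LinearMap.trace_conj' A D, coordLaplacian]
  congr 1
  ext1 z
  obtain ⟨v, rfl⟩ := D.surjective z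
  rw [LinearEquiv.conj_apply_apply, D.symm_apply_apply]
  symm
  change (metricInChart g e (e x)).inverse (coordHess (metricInChart g e) (f ∘ e.symm) (e x)
    (chartDeriv e x v)) = chartDeriv e x (A v)
  rw [hinv.inverse_apply_eq]
  ext z
  obtain ⟨w, rfl⟩ := chartDeriv_surjective he hx z
  rw [metricInChart_chartDeriv g he hx]
  have h : g.inner x ((g.inner x).inverse (hess g f x v)) = hess g f x v :=
    ((isInvertible_inner g x).inverse_apply_eq.1 rfl).symm
  exact (hess_eq_coordHess g he hx hf v w).symm.trans (DFunLike.congr_fun h w).symm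

end Charts

/-! ### The Riemannian volume in a chart -/

section PartialHomeomorph

variable {n : ℕ} {M : Type*} [TopologicalSpace M]

theorem symm_preimage_image {e : OpenPartialHomeomorph M (Coord n)} {S : Set (Coord n)}
    (hS : S ⊆ e.target) : e.symm ⁻¹' (e.symm '' S) ∩ e.target = S := by
  ext y
  constructor
  · rintro ⟨⟨z, hz, hzy⟩, hy⟩
    rwa [← e.symm.injOn (hS hz) hy hzy]
  · exact fun hy => ⟨mem_image_of_mem _ hy, hS hy⟩

theorem symm_image_subset_source {e : OpenPartialHomeomorph M (Coord n)} {S : Set (Coord n)}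
    (hS : S ⊆ e.target) : e.symm '' S ⊆ e.source :=
  image_subset_iff.2 fun _ hy => e.map_target (hS hy)

theorem comp_chart_eventuallyEq {e : OpenPartialHomeomorph M (Coord n)} {X : Type*}
    (φ : Coord n → X) {x : M} (hx : x ∈ e.source) :
    (φ ∘ e) ∘ e.symm =ᶠ[𝓝 (e x)] φ := by
  filter_upwards [e.open_target.mem_nhds (e.map_source hx)] with y hy
  simp [e.right_inv hy]

theorem isOpen_symm_image {e : OpenPartialHomeomorph M (Coord n)} {S : Set (Coord n)}
    (hS : IsOpen S) (hSe : S ⊆ e.target) :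
    IsOpen (e.symm '' S) :=
  e.symm.isOpen_image_of_subset_source hS hSe

theorem closure_symm_image_ball_subset [T2Space M] {e : OpenPartialHomeomorph M (Coord n)}
    {y₀ : Coord n} {ρ : ℝ} (hρe : Metric.closedBall y₀ ρ ⊆ e.target) :
    closure (e.symm '' Metric.ball y₀ ρ) ⊆ e.symm '' Metric.closedBall y₀ ρ :=
  closure_minimal (image_mono Metric.ball_subset_closedBall)
    (((isCompact_closedBall y₀ ρ).image_of_continuousOn (e.continuousOn_symm.mono hρe)).isClosed)

theorem closure_symm_image_ball [T2Space M] {e : OpenPartialHomeomorph M (Coord n)}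
    {y₀ : Coord n} {ρ : ℝ} (hρ : 0 < ρ) (hρe : Metric.closedBall y₀ ρ ⊆ e.target) :
    closure (e.symm '' Metric.ball y₀ ρ) = e.symm '' Metric.closedBall y₀ ρ := by
  refine (closure_symm_image_ball_subset hρe).antisymm ?_
  rw [← closure_ball y₀ hρ.ne'] at hρe ⊢
  exact (e.continuousOn_symm.mono hρe).image_closure

theorem frontier_symm_image_ball_subset [T2Space M] {e : OpenPartialHomeomorph M (Coord n)}
    {y₀ : Coord n} {ρ : ℝ} (hρe : Metric.closedBall y₀ ρ ⊆ e.target) :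
    frontier (e.symm '' Metric.ball y₀ ρ) ⊆ e.symm '' Metric.sphere y₀ ρ := by
  rw [(isOpen_symm_image Metric.isOpen_ball
    (Metric.ball_subset_closedBall.trans hρe)).frontier_eq, ← Metric.closedBall_sdiff_ball]
  rintro p ⟨hp, hpV⟩
  obtain ⟨y, hy, rfl⟩ := closure_symm_image_ball_subset hρe hp
  exact mem_image_of_mem _ ⟨hy, fun h => hpV (mem_image_of_mem _ h)⟩

variable [MeasurableSpace M] [BorelSpace M]

theorem measurableSet_symm_preimage (e : OpenPartialHomeomorph M (Coord n)) {B : Set M}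
    (hB : MeasurableSet B) : MeasurableSet (e.symm ⁻¹' B ∩ e.target) := by
  have h := (continuousOn_iff_continuous_domRestrict.1 e.continuousOn_symm).measurable hB
  have h2 := e.open_target.measurableSet.subtype_image h
  convert h2 using 1
  ext y
  simp [and_comm]

theorem measurableSet_symm_image [T2Space M] (e : OpenPartialHomeomorph M (Coord n))
    {K : Set (Coord n)} (hK : IsCompact K) (hKe : K ⊆ e.target) :
    MeasurableSet (e.symm '' K) :=
  (hK.image_of_continuousOn (e.continuousOn_symm.mono hKe)).isClosed.measurableSet

end PartialHomeomorph

section Volume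

variable {n : ℕ} {r : WithTop ℕ∞} {M : Type*} [TopologicalSpace M] [ChartedSpace (Coord n) M]
  [IsManifold (𝓡 n) ∞ M]

theorem det_gram_pullback {G G' : Coord n → Coord n →L[ℝ] Coord n →L[ℝ] ℝ} {y y' : Coord n}
    (T : Coord n →L[ℝ] Coord n) (h : ∀ v w, G' y' v w = G y (T v) (T w)) :
    (gram G' y').det = T.det ^ 2 * (gram G y).det := by
  let b := (EuclideanSpace.basisFun (Fin n) ℝ).toBasis
  let B (A : Coord n →L[ℝ] Coord n →L[ℝ] ℝ) : Coord n →ₗ[ℝ] Coord n →ₗ[ℝ] ℝ :=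
    (ContinuousLinearMap.coeLM ℝ) ∘ₗ (A : Coord n →ₗ[ℝ] Coord n →L[ℝ] ℝ)
  have hgram (G : Coord n → Coord n →L[ℝ] Coord n →L[ℝ] ℝ) (y : Coord n) :
      gram G y = LinearMap.toMatrix₂ b b (B (G y)) := by
    ext i j
    simp [gram, b, B, LinearMap.toMatrix₂_apply]
  have hB : B (G' y') = (B (G y)).compl₁₂ (T : Coord n →ₗ[ℝ] Coord n) T := by
    ext v w
    exact h v w
  rw [hgram, hgram, hB, LinearMap.toMatrix₂_compl₁₂ b b, Matrix.det_mul, Matrix.det_mul,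
    Matrix.det_transpose, LinearMap.det_toMatrix]
  change T.det * _ * T.det = _
  ring

variable {e e' : OpenPartialHomeomorph M (Coord n)}

/-- The density of the Riemannian volume in a chart. -/
def chartDensity (g : Metric n r M) (e : OpenPartialHomeomorph M (Coord n)) (y : Coord n) : ℝ :=
  Real.sqrt (gram (metricInChart g e) y).det

theorem continuousOn_chartDensity (g : Metric n 2 M) (he : e ∈ atlas (Coord n) M) :
    ContinuousOn (chartDensity g e) e.target := by
  have hG := (contDiffOn_metricInChart g he).continuousOn
  refine Real.continuous_sqrt.comp_continuousOn ?_
  have : ContinuousOn (gram (metricInChart g e)) e.target :=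
    continuousOn_pi.2 fun i => continuousOn_pi.2 fun j =>
      (hG.clm_apply continuousOn_const).clm_apply continuousOn_const
  exact (Continuous.matrix_det continuous_id).comp_continuousOn this

theorem chartDensity_transition (g : Metric n r M) (he : e ∈ atlas (Coord n) M)
    (he' : e' ∈ atlas (Coord n) M) {x : M} (hx : x ∈ e.source) (hx' : x ∈ e'.source) :
    chartDensity g e' (e' x) =
      |(fderiv ℝ (e ∘ e'.symm) (e' x)).det| * chartDensity g e (e x) := by
  rw [chartDensity, det_gram_pullback (G := metricInChart g e) (y := e x) _
    (metricInChart_transition g he he' hx hx'), Real.sqrt_mul (sq_nonneg _), Real.sqrt_sq_eq_abs,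
    chartDensity]

variable [MeasurableSpace M] [BorelSpace M]

theorem chartVolume_apply (g : Metric n r M) (e : OpenPartialHomeomorph M (Coord n)) {B : Set M}
    (hB : MeasurableSet B) :
    chartVolume g e B = ∫⁻ y in e.symm ⁻¹' B ∩ e.target, ENNReal.ofReal (chartDensity g e y) := by
  -- without this, `Measure.map` would be zero by convention
  have hm : AEMeasurable e.symm ((volume.restrict e.target).withDensity
      (fun y => ENNReal.ofReal (Real.sqrt (gram (metricInChart g e) y).det))) :=
    (e.continuousOn_symm.aemeasurable e.open_target.measurableSet).mono_ac
      (withDensity_absolutelyContinuous _ _)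
  rw [chartVolume, Measure.map_apply_of_aemeasurable hm hB, withDensity_apply',
    Measure.restrict_restrict' e.open_target.measurableSet]
  rfl

/-- On the domain of `e`, the volume in the chart `e` dominates the volume in any other chart of the
atlas, by the change of variables formula. -/
theorem chartVolume_le_chartVolume (g : Metric n r M) (he : e ∈ atlas (Coord n) M)
    (he' : e' ∈ atlas (Coord n) M) {B : Set M} (hB : MeasurableSet B) (hBe : B ⊆ e.source) :
    chartVolume g e' B ≤ chartVolume g e B := by
  rw [chartVolume_apply g e' hB, chartVolume_apply g e hB]
  set S := e'.symm ⁻¹' B ∩ e'.target with hS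
  have hd : ∀ y ∈ S, HasFDerivWithinAt (e ∘ e'.symm) (fderiv ℝ (e ∘ e'.symm) y) S y := by
    intro y hy
    have := contDiffAt_transition he he' (hBe hy.1) (e'.map_target hy.2)
    rw [e'.right_inv hy.2] at this
    exact (this.differentiableAt (by simp)).hasFDerivAt.hasFDerivWithinAt
  have hinj : InjOn (e ∘ e'.symm) S := by
    refine e.injOn.comp (e'.symm.injOn.mono fun y hy => hy.2) fun y hy => hBe hy.1
  have himg : (e ∘ e'.symm) '' S ⊆ e.symm ⁻¹' B ∩ e.target := by
    rintro _ ⟨y, hy, rfl⟩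
    have hyB : e'.symm y ∈ B := hy.1
    exact ⟨by simpa [e.left_inv (hBe hyB)] using hyB, e.map_source (hBe hyB)⟩
  calc ∫⁻ y in S, ENNReal.ofReal (chartDensity g e' y)
      = ∫⁻ y in S, ENNReal.ofReal |(fderiv ℝ (e ∘ e'.symm) y).det| *
          ENNReal.ofReal (chartDensity g e ((e ∘ e'.symm) y)) := by
        refine setLIntegral_congr_fun (measurableSet_symm_preimage e' hB) fun y hy => ?_
        have := chartDensity_transition g he he' (hBe hy.1) (e'.map_target hy.2)
        rw [e'.right_inv hy.2] at this
        rw [this, ENNReal.ofReal_mul (abs_nonneg _)]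
        rfl
    _ = ∫⁻ y in (e ∘ e'.symm) '' S, ENNReal.ofReal (chartDensity g e y) :=
        (lintegral_image_eq_lintegral_abs_det_fderiv_mul volume
          (measurableSet_symm_preimage e' hB) hd hinj
          fun y => ENNReal.ofReal (chartDensity g e y)).symm
    _ ≤ _ := lintegral_mono_set himg

/-- In the domain of a chart of the atlas, the Riemannian volume is at most the volume in this
chart. -/
theorem vol_le_chartVolume (g : Metric n r M) (he : e ∈ atlas (Coord n) M) {A : Set M}
    (hA : A ⊆ e.source) : vol g A ≤ chartVolume g e A := by
  have hs : MeasurableSet e.source := e.open_source.measurableSet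
  -- an upper bound of all chart volumes, equal to `chartVolume g e` on subsets of `e.source`
  have h : vol g ≤ chartVolume g e + (vol g).restrict e.sourceᶜ := by
    refine iSup₂_le fun e' he' => Measure.le_iff.2 fun B hB => ?_
    rw [← measure_inter_add_sdiff B hs, Measure.add_apply, Measure.restrict_apply hB, ← sdiff_eq]
    refine add_le_add ?_ ?_
    · exact (chartVolume_le_chartVolume g he he' (hB.inter hs) inter_subset_right).trans
        (measure_mono inter_subset_left)
    · exact (le_iSup₂_of_le e' he' le_rfl : chartVolume g e' ≤ vol g) _
  refine (h A).trans ?_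
  rw [Measure.add_apply, Measure.restrict_apply' hs.compl, (disjoint_compl_right_iff_subset.2
    hA).inter_eq]
  simp

theorem vol_symm_image_lt_top [T2Space M] (g : Metric n 2 M) (he : e ∈ atlas (Coord n) M)
    {K : Set (Coord n)} (hK : IsCompact K) (hKe : K ⊆ e.target) : vol g (e.symm '' K) < ⊤ := by
  refine (vol_le_chartVolume g he (symm_image_subset_source hKe)).trans_lt ?_
  rw [chartVolume_apply g e (measurableSet_symm_image e hK hKe), symm_preimage_image hKe]
  exact (((continuousOn_chartDensity g he).mono hKe).integrableOn_compact hK).lintegral_lt_top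

/-- The image of a Lebesgue null set under an inverse chart is null. -/
theorem vol_eq_zero_of_volume_eq_zero (g : Metric n r M) (he : e ∈ atlas (Coord n) M)
    {A : Set M} (hA : MeasurableSet A) (hAe : A ⊆ e.source)
    (h0 : volume (e.symm ⁻¹' A ∩ e.target) = 0) : vol g A = 0 := by
  refine le_antisymm ((vol_le_chartVolume g he hAe).trans ?_) bot_le
  rw [chartVolume_apply g e hA, setLIntegral_measure_zero _ _ h0]

theorem vol_symm_image_eq_zero [T2Space M] (g : Metric n r M) (he : e ∈ atlas (Coord n) M)
    {K : Set (Coord n)} (hK : IsCompact K) (hKe : K ⊆ e.target) (h0 : volume K = 0) :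
    vol g (e.symm '' K) = 0 :=
  vol_eq_zero_of_volume_eq_zero g he (measurableSet_symm_image e hK hKe)
    (symm_image_subset_source hKe) (by rwa [symm_preimage_image hKe])

end Volume

/-! ### Multiplier discs -/

section IntegralInequality

/-- A pointwise inequality `0 ≤ L ≤ F` on `V` can be integrated over `[0, T] × V` as soon as `F` is
continuous on `ℝ × K` for a compact set `K ⊇ V`. -/
theorem integral_integral_mono_of_continuousOn {M : Type*} [TopologicalSpace M] [MeasurableSpace M]
    [OpensMeasurableSpace M] {μ : Measure M} {V K : Set M} (hK : IsCompact K) (hVK : V ⊆ K)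
    (hV : MeasurableSet V) (hμ : μ V < ⊤) {L F : ℝ → M → ℝ}
    (hF : ContinuousOn (fun p : ℝ × M => F p.1 p.2) (univ ×ˢ K))
    (hL : ∀ t, ∀ x ∈ V, 0 ≤ L t x) (hLF : ∀ t, ∀ x ∈ V, L t x ≤ F t x) {T : ℝ} (hT : 0 < T) :
    ∫ t in (0 : ℝ)..T, ∫ x in V, L t x ∂μ ≤ ∫ t in (0 : ℝ)..T, ∫ x in V, F t x ∂μ := by
  have hfin : IsFiniteMeasure (μ.restrict V) := ⟨by simpa using hμ⟩
  obtain ⟨C, hC⟩ := (isCompact_Icc (a := (0 : ℝ)) (b := T)).prod hK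
    |>.exists_bound_of_continuousOn (hF.mono (prod_mono (subset_univ _) subset_rfl))
  have hmeas (t : ℝ) : AEStronglyMeasurable (F t) (μ.restrict V) := by
    refine ContinuousOn.aestronglyMeasurable ?_ hV
    exact hF.comp (f := fun x => (t, x)) (by fun_prop) fun x hx => ⟨mem_univ _, hVK hx⟩
  have hint (t : ℝ) (ht : t ∈ Icc 0 T) : Integrable (F t) (μ.restrict V) :=
    Integrable.of_bound (hmeas t) C
      ((ae_restrict_mem hV).mono fun x hx => hC (t, x) ⟨ht, hVK hx⟩)
  have hcont : ContinuousOn (fun t => ∫ x in V, F t x ∂μ) (Icc 0 T) := by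
    refine continuousOn_of_dominated (bound := fun _ => C) (fun t _ => hmeas t) (fun t ht => ?_)
      (integrable_const C) ?_
    · exact (ae_restrict_mem hV).mono fun x hx => hC (t, x) ⟨ht, hVK hx⟩
    · refine (ae_restrict_mem hV).mono fun x hx => ?_
      exact hF.comp (f := fun t => (t, x)) (by fun_prop) fun t _ => ⟨mem_univ _, hVK hx⟩
  rw [intervalIntegral.integral_of_le hT.le, intervalIntegral.integral_of_le hT.le]
  refine integral_mono_of_nonneg (.of_forall fun t => setIntegral_nonneg hV (hL t)) ?_ ?_
  · exact hcont.integrableOn_Icc.mono_set Ioc_subset_Icc_self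
  · refine (ae_restrict_mem measurableSet_Ioc).mono fun t ht => ?_
    exact integral_mono_of_nonneg ((ae_restrict_mem hV).mono (hL t))
      (hint t (Ioc_subset_Icc_self ht)) ((ae_restrict_mem hV).mono (hLF t))

end IntegralInequality

section Disc

theorem coordHess_congr {E : Type*} [NormedAddCommGroup E] [NormedSpace ℝ E]
    {G : E → E →L[ℝ] E →L[ℝ] ℝ} {φ ψ : E → ℝ} {y : E} (h : φ =ᶠ[𝓝 y] ψ) :
    coordHess G φ y = coordHess G ψ y := by
  rw [coordHess, coordHess, h.fderiv.fderiv_eq, h.fderiv_eq]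

variable {n : ℕ} {M : Type*} [TopologicalSpace M] [ChartedSpace (Coord n) M]
  [IsManifold (𝓡 n) ∞ M] {e : OpenPartialHomeomorph M (Coord n)}

theorem tnorm_sq (g : Metric n 2 M) {x : M} (v : TangentSpace (𝓡 n) x) :
    tnorm g v ^ 2 = innerAt g x v v := by
  refine Real.sq_sqrt ?_
  by_cases hv : v = 0
  · simp [hv]
  · exact (g.pos x v hv).le

theorem contMDiffOn_comp_chart {φ : Coord n → ℝ} (he : e ∈ atlas (Coord n) M)
    (hφ : ContDiff ℝ ∞ φ) : ContMDiffOn (𝓡 n) 𝓘(ℝ, ℝ) ∞ (φ ∘ e) e.source :=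
  hφ.contMDiff.comp_contMDiffOn
    (contMDiffOn_of_mem_maximalAtlas (IsManifold.subset_maximalAtlas he))

/-- A chart disc has smooth boundary, with defining function `‖e x - y₀‖² - ρ²`. -/
theorem hasSmoothBoundary_symm_image_ball [T2Space M] (he : e ∈ atlas (Coord n) M) {y₀ : Coord n}
    {ρ : ℝ} (hρ : 0 < ρ) (hρe : Metric.closedBall y₀ ρ ⊆ e.target) :
    HasSmoothBoundary n (e.symm '' Metric.ball y₀ ρ) := by
  have hbe : Metric.ball y₀ ρ ⊆ e.target := Metric.ball_subset_closedBall.trans hρe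
  intro p hp
  obtain ⟨z, hz, rfl⟩ := frontier_symm_image_ball_subset hρe hp
  have hzt : z ∈ e.target := hρe (Metric.sphere_subset_closedBall hz)
  have hp' : e.symm z ∈ e.source := e.map_target hzt
  have hzρ : ‖z - y₀‖ = ρ := by simpa [dist_eq_norm] using hz
  have hsm : ContDiff ℝ ∞ fun y : Coord n => ‖y - y₀‖ ^ 2 - ρ ^ 2 :=
    ((contDiff_id.sub contDiff_const).norm_sq ℝ).sub contDiff_const
  have hρs := contMDiffOn_comp_chart he hsm
  refine ⟨e.source, (fun y : Coord n => ‖y - y₀‖ ^ 2 - ρ ^ 2) ∘ e, e.open_source, hp', hρs,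
    fun h0 => ?_, ?_⟩
  · obtain ⟨v, hv⟩ := chartDeriv_surjective he hp' (z - y₀)
    have h1 := mvfderiv_eq_fderiv_chart he hp'
      ((hρs.contMDiffAt (e.open_source.mem_nhds hp')).mdifferentiableAt (by simp)) v
    rw [h0, (comp_chart_eventuallyEq _ hp').fderiv_eq, hv, e.right_inv hzt] at h1
    have h2 : HasFDerivAt (fun y : Coord n => ‖y - y₀‖ ^ 2 - ρ ^ 2)
        (2 • (innerSL ℝ (z - y₀)) ∘L ContinuousLinearMap.id ℝ (Coord n)) z :=
      (((hasFDerivAt_id z).sub_const y₀).norm_sq).sub_const _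
    rw [h2.fderiv] at h1
    have h3 : (0 : ℝ) = 2 • inner ℝ (z - y₀) (z - y₀) := h1
    rw [real_inner_self_eq_norm_sq, hzρ, two_nsmul] at h3
    have : 0 < ρ ^ 2 := by positivity
    linarith
  · ext x
    simp only [mem_inter_iff, mem_image, mem_ofPred_eq, Function.comp, Metric.mem_ball,
      dist_eq_norm]
    constructor
    · rintro ⟨⟨y, hy, rfl⟩, hx⟩
      refine ⟨hx, ?_⟩
      rw [e.right_inv (hbe (by simpa [dist_eq_norm] using hy))]
      have := pow_lt_pow_left₀ hy (norm_nonneg _) two_ne_zero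
      linarith
    · rintro ⟨hx, h⟩
      exact ⟨⟨e x, lt_of_pow_lt_pow_left₀ 2 hρ.le (by linarith), e.left_inv hx⟩, hx⟩

/-- In a chart, the gradient and the time derivative of a `C¹` function of time and space depend
continuously on time and position. -/
theorem exists_continuousOn_grad_deriv (g : Metric n 2 M) (he : e ∈ atlas (Coord n) M)
    {u : ℝ → M → ℝ}
    (hu : ContMDiff (𝓘(ℝ, ℝ).prod (𝓡 n)) 𝓘(ℝ, ℝ) 1 (fun p : ℝ × M => u p.1 p.2)) :
    ∃ (γ : ℝ × Coord n → Coord n) (δ : ℝ × Coord n → ℝ),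
      ContinuousOn γ (univ ×ˢ e.target) ∧ ContinuousOn δ (univ ×ˢ e.target) ∧
      ∀ t, ∀ x ∈ e.source, chartDeriv e x (gradAt g (u t) x) = γ (t, e x) ∧
        deriv (fun s => u s x) t = δ (t, e x) := by
  have : IsManifold (𝓡 n) 1 M := .of_le (n := ∞) (by norm_num)
  have hop : IsOpen ((univ : Set ℝ) ×ˢ e.target) := isOpen_univ.prod e.open_target
  let U : ℝ × Coord n → ℝ := fun p => u p.1 (e.symm p.2)
  have hU : ContDiffOn ℝ 1 U (univ ×ˢ e.target) := by
    rw [← contMDiffOn_iff_contDiffOn]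
    have h1 : ContMDiffOn 𝓘(ℝ, ℝ × Coord n) (𝓡 n) 1 (fun p : ℝ × Coord n => e.symm p.2)
        (univ ×ˢ e.target) :=
      (contMDiffOn_symm_of_mem_maximalAtlas (IsManifold.subset_maximalAtlas he)).comp
        contDiff_snd.contMDiff.contMDiffOn fun p hp => hp.2
    exact hu.comp_contMDiffOn ((contDiff_fst.contMDiff.contMDiffOn).prodMk h1)
  have hdU : ContinuousOn (fderiv ℝ U) (univ ×ˢ e.target) :=
    hU.continuousOn_fderiv_of_isOpen hop le_rfl
  have hG : ContinuousOn (fun p : ℝ × Coord n => (metricInChart g e p.2).inverse)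
      (univ ×ˢ e.target) :=
    (continuousOn_inverse (contDiffOn_metricInChart g he).continuousOn
      fun y hy => isInvertible_metricInChart g he hy).comp continuousOn_snd fun p hp => hp.2
  -- the gradient in the chart is `G⁻¹ dU`, for the differential `dU` in the space directions
  refine ⟨fun p => (metricInChart g e p.2).inverse
      (fderiv ℝ U p ∘L ContinuousLinearMap.inr ℝ ℝ (Coord n)), fun p => fderiv ℝ U p (1, 0),
    hG.clm_apply (hdU.clm_comp continuousOn_const), hdU.clm_apply continuousOn_const,
    fun t x hx => ?_⟩
  have hd : HasFDerivAt U (fderiv ℝ U (t, e x)) (t, e x) :=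
    ((hU.contDiffAt (hop.mem_nhds ⟨mem_univ _, e.map_source hx⟩)).differentiableAt
      (by norm_num)).hasFDerivAt
  constructor
  · have hut : MDifferentiableAt (𝓡 n) 𝓘(ℝ, ℝ) (u t) x :=
      ((hu.comp (contMDiff_const.prodMk contMDiff_id)).mdifferentiable (by norm_num)) x
    have h2 : HasFDerivAt (u t ∘ e.symm)
        (fderiv ℝ U (t, e x) ∘L ContinuousLinearMap.inr ℝ ℝ (Coord n)) (e x) :=
      hd.comp (e x) (hasFDerivAt_prodMk_right t (e x))
    rw [chartDeriv_grad g he hx hut, h2.fderiv]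
  · have h2 : HasDerivAt (fun s : ℝ => (s, e x)) ((1 : ℝ), (0 : Coord n)) t :=
      (hasDerivAt_id t).prodMk (hasDerivAt_const t (e x))
    have h3 := hd.comp_hasDerivAt t h2
    have h4 : U ∘ (fun s : ℝ => (s, e x)) = fun s => u s x := by
      ext s
      simp [U, e.left_inv hx]
    rw [h4] at h3
    exact h3.deriv

end Disc

section MultiplierDisc

variable {M : Type*} [TopologicalSpace M] [ChartedSpace (Coord 2) M]
  [IsManifold (𝓡 2) ∞ M] [MeasurableSpace M]

/-- A nonempty open set with smooth boundary of zero volume which carries a function with gradient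
bounded away from zero satisfying the multiplier inequalities with `α = 1/2` and the constant
`1/4`. Nothing is required about its topology; the examples are small chart discs. -/
structure IsMultiplierDisc (g : Metric 2 2 M) (V : Set M) : Prop where
  isOpen : IsOpen V
  nonempty : V.Nonempty
  hasSmoothBoundary : HasSmoothBoundary 2 V
  vol_frontier : vol g (frontier V) = 0
  exists_multiplier : ∃ f : M → ℝ, SmoothOnNhd 2 f (closure V) ∧
    PointwiseMultiplier g V f (1 / 2) (1 / 4) ∧ IntegralMultiplier g V f (1 / 2) (1 / 4) ∧
    0 < ⨅ x : V, tnorm g (grad g f x)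

/-- A chart disc is a multiplier disc if the multiplier inequality holds in the chart. -/
theorem isMultiplierDisc_symm_image_ball [T2Space M] [BorelSpace M] (g : Metric 2 2 M)
    {e : OpenPartialHomeomorph M (Coord 2)} (he : e ∈ atlas (Coord 2) M) {y₀ : Coord 2} {ρ : ℝ}
    (hρ : 0 < ρ) (hρe : Metric.closedBall y₀ ρ ⊆ e.target) {φ : Coord 2 → ℝ}
    (hφ : ContDiff ℝ ∞ φ) {c : ℝ} (hc : 0 < c)
    (h : ∀ y ∈ Metric.ball y₀ ρ,
      (∀ v, 1 / 4 * metricInChart g e y v v ≤ coordHess (metricInChart g e) φ y v v +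
        (1 / 2 - coordLaplacian (metricInChart g e) φ y / 2) * metricInChart g e y v v) ∧
      1 / 4 ≤ coordLaplacian (metricInChart g e) φ y / 2 - 1 / 2 ∧
      c ≤ fderiv ℝ φ y ((metricInChart g e y).inverse (fderiv ℝ φ y))) :
    IsMultiplierDisc g (e.symm '' Metric.ball y₀ ρ) := by
  have hbe : Metric.ball y₀ ρ ⊆ e.target := Metric.ball_subset_closedBall.trans hρe
  have hVs : e.symm '' Metric.ball y₀ ρ ⊆ e.source := symm_image_subset_source hbe
  have hKs : e.symm '' Metric.closedBall y₀ ρ ⊆ e.source := symm_image_subset_source hρe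
  have hVo : IsOpen (e.symm '' Metric.ball y₀ ρ) := isOpen_symm_image Metric.isOpen_ball hbe
  have heV : ∀ x ∈ e.symm '' Metric.ball y₀ ρ, e x ∈ Metric.ball y₀ ρ := by
    rintro _ ⟨y, hy, rfl⟩
    rwa [e.right_inv (hbe hy)]
  have hf := contMDiffOn_comp_chart he hφ
  have hφ2 : ContDiff ℝ 2 φ := contDiff_infty.1 hφ 2
  have hev (x : M) (hx : x ∈ e.source) := comp_chart_eventuallyEq φ hx
  have hfx (x : M) (hx : x ∈ e.source) : ContDiffAt ℝ 2 ((φ ∘ e) ∘ e.symm) (e x) :=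
    hφ2.contDiffAt.congr_of_eventuallyEq (hev x hx)
  have hH (x : M) (hx : x ∈ e.source) (v : Coord 2) : hessAt g (φ ∘ e) x v v =
      coordHess (metricInChart g e) φ (e x) (chartDeriv e x v) (chartDeriv e x v) := by
    rw [hess_eq_coordHess g he hx (hfx x hx), coordHess_congr (hev x hx)]
  have hL (x : M) (hx : x ∈ e.source) : laplacian g (φ ∘ e) x =
      coordLaplacian (metricInChart g e) φ (e x) := by
    rw [laplacian_eq_coordLaplacian g he hx (hfx x hx), coordLaplacian, coordHess_congr (hev x hx),
      coordLaplacian]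
  have hpt : PointwiseMultiplier g (e.symm '' Metric.ball y₀ ρ) (φ ∘ e) (1 / 2) (1 / 4) := by
    intro x hx
    obtain ⟨h1, h2, -⟩ := h (e x) (heV x hx)
    refine ⟨fun (v : Coord 2) => ?_, by rwa [hL x (hVs hx)]⟩
    have h3 := h1 (chartDeriv e x v)
    rw [← hH x (hVs hx), ← hL x (hVs hx), metricInChart_chartDeriv g he (hVs hx)] at h3
    exact h3
  refine ⟨hVo, ⟨_, mem_image_of_mem _ (Metric.mem_ball_self hρ)⟩,
    hasSmoothBoundary_symm_image_ball he hρ hρe,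
    measure_mono_null (frontier_symm_image_ball_subset hρe)
      (vol_symm_image_eq_zero g he (isCompact_sphere y₀ ρ)
        (Metric.sphere_subset_closedBall.trans hρe) (Measure.addHaar_sphere _ _ _)), φ ∘ e,
    ⟨e.source, e.open_source, (closure_symm_image_ball hρ hρe).trans_subset hKs, hf⟩, hpt, ?_, ?_⟩
  · intro T u hT hu
    obtain ⟨γ, δ, hγ, hδ, hu'⟩ := exists_continuousOn_grad_deriv g he hu
    simp only [← intervalIntegral.integral_const_mul, ← integral_const_mul]
    refine integral_integral_mono_of_continuousOn
      ((isCompact_closedBall y₀ ρ).image_of_continuousOn (e.continuousOn_symm.mono hρe))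
      (image_mono Metric.ball_subset_closedBall) hVo.measurableSet
      ((measure_mono (image_mono Metric.ball_subset_closedBall)).trans_lt
        (vol_symm_image_lt_top g he (isCompact_closedBall y₀ ρ) hρe)) ?_ ?_ ?_ hT
    · let G := metricInChart g e
      have hG := contDiffOn_metricInChart g he
      have hinv : ∀ y ∈ e.target, (G y).IsInvertible :=
        fun y hy => isInvertible_metricInChart g he hy
      have hG1 : ContDiffOn ℝ 1 G e.target := hG.of_le (by norm_num)
      have s2 : MapsTo Prod.snd ((univ : Set ℝ) ×ˢ e.target) e.target := fun p hp => hp.2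
      have cH := (continuousOn_coordHess e.open_target hG1 hinv hφ2.contDiffOn).comp
        continuousOn_snd s2
      have cL := (continuousOn_coordLaplacian e.open_target hG1 hinv hφ2.contDiffOn).comp
        continuousOn_snd s2
      have cG := hG.continuousOn.comp continuousOn_snd s2
      have key : ContinuousOn (fun p : ℝ × Coord 2 =>
          coordHess G φ p.2 (γ p) (γ p) + (1 / 2 - coordLaplacian G φ p.2 / 2) * G p.2 (γ p) (γ p)
            + (coordLaplacian G φ p.2 / 2 - 1 / 2) * δ p ^ 2) (univ ×ˢ e.target) :=
        (((cH.clm_apply hγ).clm_apply hγ).add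
          ((continuousOn_const.sub (cL.div_const 2)).mul ((cG.clm_apply hγ).clm_apply hγ))).add
          (((cL.div_const 2).sub continuousOn_const).mul (hδ.pow 2))
      have hmap : ContinuousOn (fun p : ℝ × M => (p.1, e p.2))
          (univ ×ˢ (e.symm '' Metric.closedBall y₀ ρ)) :=
        continuousOn_fst.prodMk
          (e.continuousOn.comp continuousOn_snd fun p hp => hKs hp.2)
      refine (key.comp hmap fun p hp => ⟨mem_univ _, e.map_source (hKs hp.2)⟩).congr ?_
      rintro ⟨t, x⟩ ⟨-, hx⟩
      obtain ⟨h1, h2⟩ := hu' t x (hKs hx)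
      have h3 : hess g (φ ∘ e) x (grad g (u t) x) (grad g (u t) x) =
          coordHess G φ (e x) (γ (t, e x)) (γ (t, e x)) := by
        rw [← h1]
        exact hH x (hKs hx) (gradAt g (u t) x)
      have h4 : tnorm g (grad g (u t) x) ^ 2 = G (e x) (γ (t, e x)) (γ (t, e x)) := by
        rw [← h1, metricInChart_chartDeriv g he (hKs hx)]
        exact tnorm_sq g _
      simp only [Function.comp, h3, h4, h2, hL x (hKs hx)]
      rfl
    · intro t x _
      positivity
    · intro t x hx
      obtain ⟨h1, h2⟩ := hpt x hx
      have h3 := h1 (grad g (u t) x)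
      have h4 : tnorm g (grad g (u t) x) ^ 2 = g.inner x (grad g (u t) x) (grad g (u t) x) :=
        tnorm_sq g _
      have h5 := mul_le_mul_of_nonneg_right h2 (sq_nonneg (deriv (fun s => u s x) t))
      rw [h4]
      linarith
  · have hne : Nonempty (e.symm '' Metric.ball y₀ ρ) :=
      ⟨_, mem_image_of_mem _ (Metric.mem_ball_self hρ)⟩
    refine (Real.sqrt_pos.2 hc).trans_le (le_ciInf fun ⟨x, hx⟩ => Real.sqrt_le_sqrt ?_)
    have hmd : MDifferentiableAt (𝓡 2) 𝓘(ℝ, ℝ) (φ ∘ e) x :=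
      (hf.contMDiffAt (e.open_source.mem_nhds (hVs hx))).mdifferentiableAt (by simp)
    have h1 := chartDeriv_grad g he (hVs hx) hmd
    rw [(hev x (hVs hx)).fderiv_eq] at h1
    have h2 : innerAt g x (gradAt g (φ ∘ e) x) (gradAt g (φ ∘ e) x) =
        fderiv ℝ φ (e x) ((metricInChart g e (e x)).inverse (fderiv ℝ φ (e x))) := by
      have h3 : fderiv ℝ φ (e x) = metricInChart g e (e x)
          ((metricInChart g e (e x)).inverse (fderiv ℝ φ (e x))) :=
        ((isInvertible_metricInChart g he (e.map_source (hVs hx))).inverse_apply_eq).1 rfl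
      rw [← metricInChart_chartDeriv g he (hVs hx), h1]
      exact (DFunLike.congr_fun h3 _).symm
    exact ((h (e x) (heV x hx)).2.2).trans_eq h2.symm

/-- Around every point of a chart target, all sufficiently small chart discs are multiplier
discs. -/
theorem eventually_isMultiplierDisc [T2Space M] [BorelSpace M] (g : Metric 2 2 M)
    {e : OpenPartialHomeomorph M (Coord 2)} (he : e ∈ atlas (Coord 2) M) {y₀ : Coord 2}
    (hy₀ : y₀ ∈ e.target) :
    ∃ R > 0, ∀ ρ, 0 < ρ → ρ < R → IsMultiplierDisc g (e.symm '' Metric.ball y₀ ρ) := by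
  obtain ⟨φ, hφ, c, hc, hev⟩ := exists_local_multiplier (by simp) e.open_target
    ((contDiffOn_metricInChart g he).of_le (by norm_num))
    (fun y _ => metricInChart_symm g e y) (fun y hy => metricInChart_pos g he hy) hy₀
  obtain ⟨R, hR, hball⟩ := Metric.eventually_nhds_iff_ball.1
    (hev.and (e.open_target.eventually_mem hy₀))
  refine ⟨R, hR, fun ρ hρ hρR => isMultiplierDisc_symm_image_ball g he hρ
    (fun y hy => (hball y (Metric.closedBall_subset_ball hρR hy)).2) hφ hc fun y hy =>
      (hball y (Metric.ball_subset_ball hρR.le hy)).1⟩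

end MultiplierDisc

/-! ### Filling a compact surface with multiplier discs -/

section Filling

variable {M : Type*} [TopologicalSpace M] [ChartedSpace (Coord 2) M] [IsManifold (𝓡 2) ∞ M]
  [MeasurableSpace M] [T2Space M] [BorelSpace M]

/-- An open subset of a chart domain is covered by countably many disjoint closed multiplier discs,
up to a null set: this is the Besicovitch covering theorem in the chart. -/
theorem exists_countable_multiplierDisc (g : Metric 2 2 M)
    {e : OpenPartialHomeomorph M (Coord 2)} (he : e ∈ atlas (Coord 2) M) {O : Set M}
    (hO : IsOpen O) (hOe : O ⊆ e.source) :
    ∃ (t : Set (Coord 2)) (V : Coord 2 → Set M), t.Countable ∧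
      (∀ y ∈ t, IsMultiplierDisc g (V y) ∧ closure (V y) ⊆ O) ∧
      t.PairwiseDisjoint (fun y => closure (V y)) ∧
      vol g (O \ ⋃ y ∈ t, closure (V y)) = 0 := by
  set Ω : Set (Coord 2) := e.target ∩ e.symm ⁻¹' O
  have hΩ : IsOpen Ω := e.isOpen_inter_preimage_symm hO
  have hR : ∀ y ∈ Ω, ∃ R > 0, ∀ ρ, 0 < ρ → ρ < R →
      IsMultiplierDisc g (e.symm '' Metric.ball y ρ) ∧ Metric.closedBall y ρ ⊆ Ω := by
    intro y hy
    obtain ⟨R₁, hR₁, h₁⟩ := eventually_isMultiplierDisc g he hy.1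
    obtain ⟨R₂, hR₂, h₂⟩ := Metric.isOpen_iff.1 hΩ y hy
    exact ⟨min R₁ R₂, lt_min hR₁ hR₂, fun ρ hρ hlt => ⟨h₁ ρ hρ (hlt.trans_le (min_le_left _ _)),
      (Metric.closedBall_subset_ball (hlt.trans_le (min_le_right _ _))).trans h₂⟩⟩
  choose! R hR0 hR using hR
  obtain ⟨t, ρ, htc, htΩ, hρ, hnull, hdisj⟩ := Besicovitch.exists_disjoint_closedBall_covering_ae
    (volume : Measure (Coord 2)) (fun _ => univ) Ω
    (fun y _ δ hδ => ⟨δ / 2, mem_univ _, by constructor <;> linarith⟩) R hR0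
  have hdisc (y) (hy : y ∈ t) := hR y (htΩ hy) (ρ y) (hρ y hy).2.1 (hρ y hy).2.2
  have hcl (y) (hy : y ∈ t) : closure (e.symm '' Metric.ball y (ρ y)) =
      e.symm '' Metric.closedBall y (ρ y) :=
    closure_symm_image_ball (hρ y hy).2.1 ((hdisc y hy).2.trans inter_subset_left)
  refine ⟨t, fun y => e.symm '' Metric.ball y (ρ y), htc, fun y hy => ⟨(hdisc y hy).1, ?_⟩, ?_, ?_⟩
  · rw [hcl y hy]
    exact image_subset_iff.2 fun z hz => ((hdisc y hy).2 hz).2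
  · intro y hy z hz hyz
    simp only [Function.onFun]
    rw [hcl y hy, hcl z hz]
    refine disjoint_left.2 ?_
    rintro _ ⟨a, ha, rfl⟩ ⟨b, hb, hab⟩
    rw [e.symm.injOn ((hdisc z hz).2 hb).1 ((hdisc y hy).2 ha).1 hab] at hb
    exact disjoint_left.1 (hdisj hy hz hyz) ha hb
  · refine vol_eq_zero_of_volume_eq_zero g he (hO.measurableSet.diff
      (.biUnion htc fun y _ => isClosed_closure.measurableSet)) (sdiff_subset.trans hOe)
      (measure_mono_null ?_ hnull)
    rintro y ⟨⟨hyO, hyU⟩, hye⟩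
    refine ⟨⟨hye, hyO⟩, fun hy => hyU ?_⟩
    simp only [mem_iUnion] at hy ⊢
    obtain ⟨z, hz, hyz⟩ := hy
    exact ⟨z, hz, (hcl z hz).symm ▸ mem_image_of_mem _ hyz⟩

/-- An open subset of finite volume of a chart domain is filled up to a set of small volume by
finitely many disjoint closed multiplier discs. -/
theorem exists_finite_multiplierDisc (g : Metric 2 2 M)
    {e : OpenPartialHomeomorph M (Coord 2)} (he : e ∈ atlas (Coord 2) M) {O : Set M}
    (hO : IsOpen O) (hOe : O ⊆ e.source) (hfin : vol g O ≠ ⊤) {η : ℝ≥0∞} (hη : 0 < η) :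
    ∃ 𝒱 : Set (Set M), 𝒱.Finite ∧ (∀ V ∈ 𝒱, IsMultiplierDisc g V ∧ closure V ⊆ O) ∧
      𝒱.PairwiseDisjoint closure ∧ vol g (O \ ⋃ V ∈ 𝒱, closure V) ≤ η := by
  obtain ⟨t, V, htc, hV, hdisj, hnull⟩ := exists_countable_multiplierDisc g he hO hOe
  rcases t.eq_empty_or_nonempty with rfl | hne
  · exact ⟨∅, finite_empty, by simp, by simp, by simp_all⟩
  obtain ⟨x, rfl⟩ := htc.exists_eq_range hne
  let A : ℕ → Set M := fun k => O \ ⋃ i < k, closure (V (x i))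
  have hA : Tendsto (fun k => vol g (A k)) atTop (𝓝 (vol g (⋂ k, A k))) := by
    refine tendsto_measure_iInter_atTop (fun k => (hO.measurableSet.diff (.biUnion
      (Set.to_countable _) fun y _ => isClosed_closure.measurableSet)).nullMeasurableSet) ?_
      ⟨0, measure_ne_top_of_subset sdiff_subset hfin⟩
    intro k l hkl
    exact sdiff_subset_sdiff_right (biUnion_subset_biUnion_left fun i hi => lt_of_lt_of_le hi hkl)
  have h0 : vol g (⋂ k, A k) = 0 := by
    refine measure_mono_null (fun p hp => ?_) hnull
    rw [mem_iInter] at hp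
    refine ⟨(hp 0).1, fun hmem => ?_⟩
    simp only [mem_iUnion, mem_range] at hmem
    obtain ⟨_, ⟨i, rfl⟩, hi⟩ := hmem
    exact (hp (i + 1)).2 (mem_biUnion (Nat.lt_succ_self i) hi)
  rw [h0] at hA
  obtain ⟨k, hk⟩ := (hA.eventually (gt_mem_nhds hη)).exists
  refine ⟨(V ∘ x) '' Iio k, (finite_Iio k).image _, ?_, ?_, ?_⟩
  · rintro _ ⟨i, -, rfl⟩
    exact hV _ (mem_range_self i)
  · rintro _ ⟨i, -, rfl⟩ _ ⟨j, -, rfl⟩ hij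
    exact hdisj (mem_range_self i) (mem_range_self j) fun h => hij (congrArg V h)
  · rw [biUnion_image]
    exact hk.le

/-- Finitely many open chart pieces of finite volume are filled one after the other: the discs in
the next piece are chosen in the complement of the closed discs found so far. -/
theorem exists_finite_multiplierDisc_biUnion (g : Metric 2 2 M) {ι : Type*} (s : Finset ι)
    (A : ι → Set M) (hA : ∀ i, IsOpen (A i)) (hfin : ∀ i, vol g (A i) ≠ ⊤)
    (hchart : ∀ i, ∃ e ∈ atlas (Coord 2) M, A i ⊆ e.source) :
    ∀ η : ℝ≥0∞, 0 < η → ∃ 𝒱 : Set (Set M), 𝒱.Finite ∧ (∀ V ∈ 𝒱, IsMultiplierDisc g V) ∧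
      𝒱.PairwiseDisjoint closure ∧ vol g ((⋃ i ∈ s, A i) \ ⋃ V ∈ 𝒱, closure V) ≤ η := by
  classical
  induction s using Finset.induction_on with
  | empty => exact fun η _ => ⟨∅, finite_empty, by simp, by simp, by simp⟩
  | insert i s _ ih =>
    intro η hη
    obtain ⟨𝒱, h𝒱, hV, hVd, hVη⟩ := ih (η / 2) (ENNReal.half_pos hη.ne')
    obtain ⟨e, he, hAe⟩ := hchart i
    have hcl : IsClosed (⋃ V ∈ 𝒱, closure V) := h𝒱.isClosed_biUnion fun _ _ => isClosed_closure
    obtain ⟨𝒲, h𝒲, hW, hWd, hWη⟩ := exists_finite_multiplierDisc g he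
      ((hA i).sdiff hcl) (sdiff_subset.trans hAe)
      (measure_ne_top_of_subset sdiff_subset (hfin i)) (ENNReal.half_pos hη.ne')
    refine ⟨𝒱 ∪ 𝒲, h𝒱.union h𝒲, ?_, ?_, ?_⟩
    · rintro V (h | h)
      exacts [hV V h, (hW V h).1]
    · refine (pairwiseDisjoint_union).2 ⟨hVd, hWd, fun V hV' W hW' _ => ?_⟩
      refine disjoint_left.2 fun p hp hp' => ((hW W hW').2 hp').2 (mem_biUnion hV' hp)
    · calc vol g ((⋃ j ∈ insert i s, A j) \ ⋃ V ∈ 𝒱 ∪ 𝒲, closure V)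
          ≤ vol g (((⋃ j ∈ s, A j) \ ⋃ V ∈ 𝒱, closure V) ∪
              ((A i \ ⋃ V ∈ 𝒱, closure V) \ ⋃ W ∈ 𝒲, closure W)) := by
            refine measure_mono ?_
            rw [Finset.set_biUnion_insert, biUnion_union]
            rintro p ⟨hp | hp, hn⟩
            · exact Or.inr ⟨⟨hp, fun h => hn (Or.inl h)⟩, fun h => hn (Or.inr h)⟩
            · exact Or.inl ⟨hp, fun h => hn (Or.inl h)⟩
        _ ≤ η / 2 + η / 2 := (measure_union_le _ _).trans (add_le_add hVη hWη)
        _ = η := ENNReal.add_halves η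

/-- A compact surface is filled up to a set of small volume by finitely many multiplier discs with
disjoint closures. -/
theorem exists_multiplierDisc_filling [CompactSpace M] (g : Metric 2 2 M) {η : ℝ≥0∞}
    (hη : 0 < η) :
    ∃ 𝒱 : Set (Set M), 𝒱.Finite ∧ (∀ V ∈ 𝒱, IsMultiplierDisc g V) ∧
      𝒱.PairwiseDisjoint closure ∧ vol g (⋃ V ∈ 𝒱, V)ᶜ ≤ η := by
  have hpatch (p : M) : ∃ A : Set M, IsOpen A ∧ p ∈ A ∧ vol g A ≠ ⊤ ∧
      ∃ e ∈ atlas (Coord 2) M, A ⊆ e.source := by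
    let e := chartAt (Coord 2) p
    have hp := mem_chart_source (Coord 2) p
    have he : e ∈ atlas (Coord 2) M := chart_mem_atlas _ p
    obtain ⟨ρ, hρ, hball⟩ := Metric.nhds_basis_closedBall.mem_iff.1
      (e.open_target.mem_nhds (e.map_source hp))
    have hbe := Metric.ball_subset_closedBall.trans hball
    refine ⟨e.symm '' Metric.ball (e p) ρ, isOpen_symm_image Metric.isOpen_ball hbe,
      ⟨e p, Metric.mem_ball_self hρ, e.left_inv hp⟩, ?_, e, he, symm_image_subset_source hbe⟩
    exact measure_ne_top_of_subset (image_mono Metric.ball_subset_closedBall)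
      (vol_symm_image_lt_top g he (isCompact_closedBall _ _) hball).ne
  choose A hAo hpA hAfin hAe using hpatch
  obtain ⟨s, hs⟩ := CompactSpace.elim_nhds_subcover A fun p => (hAo p).mem_nhds (hpA p)
  obtain ⟨𝒱, h𝒱, hV, hVd, hVη⟩ := exists_finite_multiplierDisc_biUnion g s A hAo hAfin hAe η hη
  refine ⟨𝒱, h𝒱, hV, hVd, ?_⟩
  have hfr : vol g (⋃ V ∈ 𝒱, frontier V) = 0 :=
    (measure_biUnion_null_iff h𝒱.countable).2 fun V h => (hV V h).vol_frontier
  have hsub : (⋃ V ∈ 𝒱, V)ᶜ ⊆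
      ((⋃ p ∈ s, A p) \ ⋃ V ∈ 𝒱, closure V) ∪ ⋃ V ∈ 𝒱, frontier V := by
    intro p hp
    by_cases hc : p ∈ ⋃ V ∈ 𝒱, closure V
    · right
      simp only [mem_iUnion] at hc ⊢
      obtain ⟨V, h, hpV⟩ := hc
      refine ⟨V, h, ?_⟩
      rw [(hV V h).isOpen.frontier_eq]
      exact ⟨hpV, fun h' => hp (mem_biUnion h h')⟩
    · exact Or.inl ⟨hs.symm ▸ mem_univ p, hc⟩
  refine (measure_mono hsub).trans ((measure_union_le _ _).trans ?_)
  rwa [hfr, add_zero]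

end Filling

end Riem

end

theorem mainTheorem2 {M : Type*} [TopologicalSpace M] [T2Space M] [CompactSpace M]
    [ChartedSpace (Riem.Coord 2) M] [IsManifold (𝓡 2) ∞ M] [MeasurableSpace M] [BorelSpace M]
    (g : Riem.Metric 2 2 M) (ε : ℝ) (hε : 0 < ε) :
    ∃ (k : ℕ) (V : Fin k → Set M) (f : Fin k → M → ℝ) (C : ℝ),
      0 < C ∧
      (∀ i, IsOpen (V i) ∧ Riem.HasSmoothBoundary 2 (V i)) ∧
      (∀ i, Riem.SmoothOnNhd 2 (f i) (closure (V i))) ∧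
      (Pairwise fun i j => Disjoint (closure (V i)) (closure (V j))) ∧
      Riem.vol g univ - ENNReal.ofReal ε ≤ Riem.vol g (⋃ i, V i) ∧
      (∀ i, Riem.PointwiseMultiplier g (V i) (f i) (2 / 2 - 1 / 2) C ∧
        Riem.IntegralMultiplier g (V i) (f i) (2 / 2 - 1 / 2) C) ∧
      (∀ i, (V i).Nonempty ∧ 0 < ⨅ x : V i, Riem.tnorm g (Riem.grad g (f i) x)) := by
  obtain ⟨𝒱, h𝒱, hV, hVd, hVη⟩ :=
    Riem.exists_multiplierDisc_filling g (ENNReal.ofReal_pos.2 hε)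
  have := h𝒱.to_subtype
  obtain ⟨k, ⟨E⟩⟩ := Finite.exists_equiv_fin 𝒱
  have hE (i : Fin k) := hV _ (E.symm i).2
  choose f hf hpt hint hgrad using fun i => (hE i).exists_multiplier
  have hα : (2 / 2 - 1 / 2 : ℝ) = 1 / 2 := by norm_num
  rw [hα]
  refine ⟨k, fun i => E.symm i, f, 1 / 4, by norm_num,
    fun i => ⟨(hE i).isOpen, (hE i).hasSmoothBoundary⟩, hf, ?_, ?_, fun i => ⟨hpt i, hint i⟩,
    fun i => ⟨(hE i).nonempty, hgrad i⟩⟩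
  · intro i j hij
    exact hVd (E.symm i).2 (E.symm j).2 fun h => hij (E.symm.injective (Subtype.ext h))
  · have hU : ⋃ i, ((E.symm i : 𝒱) : Set M) = ⋃ V ∈ 𝒱, V := by
      rw [E.symm.surjective.iUnion_comp fun V : 𝒱 => (V : Set M), iUnion_subtype]
    rw [hU, tsub_le_iff_right]
    refine (measure_mono (union_compl_self _).ge).trans
      ((measure_union_le (⋃ V ∈ 𝒱, V) _).trans ?_)
    gcongr
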